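/- Let $K$ be an algebraically closed field of characteristic zero. For positive integers $m_1<\dots<m_n$ with $\gcd(m_1,\dots,m_n)=1$, let $\overline{C}(m_1,\dots,m_n)\subset\mathbb{P}^n$ denote the projective monomial curve over $K$ with generic zero $(u^{m_n},u^{m_n-m_1}v^{m_1},\dots,u^{m_n-m_{n-1}}v^{m_{n-1}},v^{m_n})$, that is, the zero set in $\mathbb{P}^n$ of all polynomials in $K[x_0,\dots,x_n]$ that vanish at this point with coordinates in $K[u,v]$. A curve in $\mathbb{P}^n$ is a set-theoretic complete intersection if it is the intersection of $n-1$ hypersurfaces, and it is arithmetically Cohen–Macaulay if its homogeneous coordinate ring is Cohen–Macaulay. Let $0<m_1<m_2<m_3$ be integers with $\gcd(m_1,m_2,m_3)=1$ such that $\overline{C}(m_1,m_2,m_3)\subset\mathbb{P}^3$ is arithmetically Cohen–Macaulay, and let $\ell,s_3$ be positive integers with $s_3>\ell$ and $\gcd(\ell,s_3m_3)=1$. Then the curve $\overline{C}(\ell m_1,\ell m_2,\ell m_3,s_3m_3)\subset\mathbb{P}^4$ is a set-theoretic complete intersection. -/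

import Mathlib

open scoped LinearAlgebra.Projectivization

namespace MonomialCurves

noncomputable section

/-- A Noetherian local ring is Cohen-Macaulay if its maximal ideal contains a regular sequence
whose length is the Krull dimension of the ring (that is, depth equals dimension). -/
def IsCohenMacaulayLocalRing (R : Type*) [CommRing R] [IsLocalRing R] : Prop :=
  IsNoetherianRing R ∧ ∃ rs : List R,
    (∀ r ∈ rs, r ∈ IsLocalRing.maximalIdeal R) ∧
    RingTheory.Sequence.IsRegular R rs ∧
    (rs.length : WithBot ℕ∞) = ringKrullDim R

/-- A Noetherian ring is Cohen-Macaulay if its localizations at all prime ideals are. -/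
def IsCohenMacaulayRing (R : Type*) [CommRing R] : Prop :=
  IsNoetherianRing R ∧ ∀ (p : Ideal R) [p.IsPrime],
    IsCohenMacaulayLocalRing (Localization.AtPrime p)

/-- Projective `n`-space over `K`: the lines through the origin of `K^(n+1)`. -/
abbrev ProjSpace (K : Type*) [Field K] (n : ℕ) : Type _ := ℙ K (Fin (n + 1) → K)

variable {K : Type*} [Field K] {n : ℕ}

/-- The common zeros in projective `n`-space of a set `S` of polynomials. It is only used for
sets of homogeneous polynomials and for homogeneous ideals, where the vanishing does not depend
on the representative of the point. -/
def zeroLocus (S : Set (MvPolynomial (Fin (n + 1)) K)) : Set (ProjSpace K n) :=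
  {P | ∀ f ∈ S, MvPolynomial.eval P.rep f = 0}

/-- The homogeneous ideal of a subset `X` of projective `n`-space, generated by the homogeneous
polynomials that vanish on `X`. -/
def homogeneousVanishingIdeal (X : Set (ProjSpace K n)) :
    Ideal (MvPolynomial (Fin (n + 1)) K) :=
  Ideal.span {f | (∃ d, f.IsHomogeneous d) ∧ ∀ P ∈ X, MvPolynomial.eval P.rep f = 0}

/-- `X` is arithmetically Cohen-Macaulay: its homogeneous coordinate ring is Cohen-Macaulay. -/
def IsArithmeticallyCohenMacaulay (X : Set (ProjSpace K n)) : Prop :=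
  IsCohenMacaulayRing (MvPolynomial (Fin (n + 1)) K ⧸ homogeneousVanishingIdeal X)

/-- A curve `X` in projective `n`-space is a set-theoretic complete intersection if it is the
intersection of `n - 1` hypersurfaces (zero sets of nonzero forms of positive degree). -/
def IsSetTheoreticCompleteIntersectionCurve (X : Set (ProjSpace K n)) : Prop :=
  ∃ f : Fin (n - 1) → MvPolynomial (Fin (n + 1)) K,
    (∀ i, f i ≠ 0 ∧ ∃ d, 0 < d ∧ (f i).IsHomogeneous d) ∧
    X = zeroLocus (Set.range f)

/-- The exponents `0, m₁, …, mₙ` of `v` in the generic zero of a projective monomial curve. -/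
def exponent (m : Fin n → ℕ) : Fin (n + 1) → ℕ := Fin.cons 0 m

/-- The point `(u^{mₙ}, u^{mₙ-m₁} v^{m₁}, …, u^{mₙ-mₙ₋₁} v^{mₙ₋₁}, v^{mₙ})` with coordinates in
`K[u, v]`, where `u` and `v` are the variables `X 0` and `X 1`. -/
def genericZero (K : Type*) [Field K] (m : Fin n → ℕ) (i : Fin (n + 1)) :
    MvPolynomial (Fin 2) K :=
  MvPolynomial.X 0 ^ (exponent m (Fin.last n) - exponent m i) * MvPolynomial.X 1 ^ exponent m i

/-- The projective monomial curve `C̄(m₁, …, mₙ)`, for positive integers `m₁ < ⋯ < mₙ` of greatest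
common divisor one: the variety in projective `n`-space whose generic zero is `genericZero K m`,
that is, the zero locus of all the polynomials that vanish at this generic point. -/
def projMonomialCurve (K : Type*) [Field K] (m : Fin n → ℕ) : Set (ProjSpace K n) :=
  zeroLocus {f | MvPolynomial.aeval (genericZero K m) f = 0}

end

end MonomialCurves

namespace MonomialCurves

/-! Give x₀, x₁, x₂, x₃ the bidegrees (1, 0), (1, m₁), (1, m₂), (1, m₃). Cohen–Macaulayness of the
curve in ℙ³ enters only as a saturation property: a bidegree belongs to the semigroup of monomials
as soon as its translates by (1, 0) and by (1, m₃) do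
(`isMonomialDegree_of_isArithmeticallyCohenMacaulay`). It follows that the monomials in x₁, x₂
outside (x₀, x₃) are determined by their weight modulo m₃ (`IsStandardExponent.eq_of_dvd`), and then
that two binomials F = x₁^α - x₂^c x₀^p x₃^q and f = x₂^β - x₁^d x₀^p' x₃^q', with c < β and d < α,
generate all relations of weights modulo m₃ (`exists_binomialExponents`).

F = f = 0 gives the curve on the torus, but when c, d > 0 it also contains the line x₁ = x₂ = 0. So
f is replaced by G: reducing f^α modulo F leaves x₂^(cd) G (`pow_mul_reducedPower`). Thus F = G = 0
still forces f = 0, while on x₂ = 0 the form G is, up to sign, a monomial in x₀, x₃, which removes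
the line.

In ℙ⁴ the third form is H = x₃^s - x₄^ℓ x₀^(s-ℓ). For x₀ = 1, F and G give xᵢ = t^mᵢ, H gives t^(s
m₃) = x₄^ℓ, and coprimality yields a common parameter v with t = v^ℓ and x₄ = v^(s m₃). For x₀ = 0,
H kills x₃ and then F, G kill x₁, x₂, leaving only (0 : 0 : 0 : 0 : 1), a point of the curve. -/

/-- The pairs (degree, weight) of the monomials in four variables of degree one and of weights
`0, m₁, m₂, m₃`. -/
def IsMonomialDegree (m₁ m₂ m₃ : ℕ) (D W : ℤ) : Prop :=
  ∃ i a b j : ℕ, D = i + a + b + j ∧ W = a * m₁ + b * m₂ + j * m₃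

/-- The exponents of the monomials in the two middle variables that are divisible by neither of
the outer variables modulo the relations of the curve. -/
def IsStandardExponent (m₁ m₂ m₃ : ℕ) (a b : ℕ) : Prop :=
  ¬ IsMonomialDegree m₁ m₂ m₃ ((a : ℤ) + b - 1) (a * m₁ + b * m₂) ∧
  ¬ IsMonomialDegree m₁ m₂ m₃ ((a : ℤ) + b - 1) (a * m₁ + b * m₂ - m₃)

/-! ### The semigroup of bidegrees and its two generating binomials. -/

section Semigroup

variable {m₁ m₂ m₃ : ℕ}

theorem IsMonomialDegree.add {D W D' W' : ℤ} (h : IsMonomialDegree m₁ m₂ m₃ D W)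
    (h' : IsMonomialDegree m₁ m₂ m₃ D' W') : IsMonomialDegree m₁ m₂ m₃ (D + D') (W + W') := by
  obtain ⟨i, a, b, j, hD, hW⟩ := h
  obtain ⟨i', a', b', j', hD', hW'⟩ := h'
  refine ⟨i + i', a + a', b + b', j + j', ?_, ?_⟩
  · push_cast; linarith
  · push_cast; rw [hW, hW']; ring

theorem isMonomialDegree_of_exponents (i a b j : ℕ) :
    IsMonomialDegree m₁ m₂ m₃ (i + a + b + j) (a * m₁ + b * m₂ + j * m₃) :=
  ⟨i, a, b, j, rfl, rfl⟩

theorem IsStandardExponent.mono {a b a' b' : ℕ} (h : IsStandardExponent m₁ m₂ m₃ a b)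
    (ha : a' ≤ a) (hb : b' ≤ b) : IsStandardExponent m₁ m₂ m₃ a' b' := by
  obtain ⟨a, rfl⟩ := Nat.exists_eq_add_of_le ha
  obtain ⟨b, rfl⟩ := Nat.exists_eq_add_of_le hb
  constructor
  · intro h'
    apply h.1
    convert h'.add (isMonomialDegree_of_exponents 0 a b 0) using 1 <;> push_cast <;> ring
  · intro h'
    apply h.2
    convert h'.add (isMonomialDegree_of_exponents 0 a b 0) using 1 <;> push_cast <;> ring

theorem isStandardExponent_zero : IsStandardExponent m₁ m₂ m₃ 0 0 := by
  constructor <;> rintro ⟨i, a, b, j, h, -⟩ <;> push_cast at h <;> omega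

theorem exists_isStandardExponent (a b : ℕ) :
    ∃ e f i j : ℕ, IsStandardExponent m₁ m₂ m₃ e f ∧ a + b = e + f + i + j ∧
      a * m₁ + b * m₂ = e * m₁ + f * m₂ + j * m₃ := by
  induction hn : a + b using Nat.strong_induction_on generalizing a b with
  | _ n ih =>
  subst hn
  by_cases h : IsStandardExponent m₁ m₂ m₃ a b
  · exact ⟨a, b, 0, 0, h, by simp, by simp⟩
  · rw [IsStandardExponent, not_and_or, not_not, not_not] at h
    rcases h with ⟨i, a', b', j, hD, hW⟩ | ⟨i, a', b', j, hD, hW⟩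
    · obtain ⟨e, f, i', j', hs, hD', hW'⟩ := ih (a' + b') (by omega) a' b' rfl
      refine ⟨e, f, i + i' + 1, j + j', hs, by omega, ?_⟩
      zify at hW' ⊢
      linarith
    · obtain ⟨e, f, i', j', hs, hD', hW'⟩ := ih (a' + b') (by omega) a' b' rfl
      refine ⟨e, f, i + i', j + j' + 1, hs, by omega, ?_⟩
      zify at hW' ⊢
      linarith

theorem IsMonomialDegree.of_add_left_of_add_right
    (hsat : ∀ D W : ℤ, IsMonomialDegree m₁ m₂ m₃ (D + 1) W →
      IsMonomialDegree m₁ m₂ m₃ (D + 1) (W + m₃) → IsMonomialDegree m₁ m₂ m₃ D W)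
    (i j : ℕ) {D W : ℤ} (h : IsMonomialDegree m₁ m₂ m₃ (D + i) W)
    (h' : IsMonomialDegree m₁ m₂ m₃ (D + j) (W + j * m₃)) : IsMonomialDegree m₁ m₂ m₃ D W := by
  induction i generalizing D W j with
  | zero => simpa using h
  | succ i ih =>
    induction j generalizing D W with
    | zero => simpa using h'
    | succ j jh =>
      apply hsat
      · refine ih (j + 1) (by convert h using 1; push_cast; ring) ?_
        convert h'.add (isMonomialDegree_of_exponents 1 0 0 0) using 1 <;> push_cast <;> ring
      · apply jh
        · convert h.add (isMonomialDegree_of_exponents 0 0 0 1) using 1 <;> push_cast <;> ring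
        · convert h' using 1 <;> push_cast <;> ring

/-- Freeness over K[x₀, x₃] in combinatorial form: standard monomials whose weights agree modulo m₃
differ by powers of x₀ and x₃, and such powers must be trivial. -/
theorem IsStandardExponent.eq_of_le
    (hsat : ∀ D W : ℤ, IsMonomialDegree m₁ m₂ m₃ (D + 1) W →
      IsMonomialDegree m₁ m₂ m₃ (D + 1) (W + m₃) → IsMonomialDegree m₁ m₂ m₃ D W)
    (h₁₂ : m₁ < m₂) {a b a' b' : ℕ}
    (h : IsStandardExponent m₁ m₂ m₃ a b) (h' : IsStandardExponent m₁ m₂ m₃ a' b') (j : ℕ)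
    (hj : (a' : ℤ) * m₁ + b' * m₂ = a * m₁ + b * m₂ + j * m₃) : a = a' ∧ b = b' := by
  have hS := isMonomialDegree_of_exponents (m₁ := m₁) (m₂ := m₂) (m₃ := m₃) 0 a b 0
  have hS' := isMonomialDegree_of_exponents (m₁ := m₁) (m₂ := m₂) (m₃ := m₃) 0 a' b' 0
  rcases le_or_gt (a + b + j : ℤ) (a' + b') with hle | hlt
  · obtain ⟨i, hi⟩ := Int.le.dest hle
    rcases j with _ | j
    · rcases i with _ | i
      · have hs : (a' : ℤ) + b' = a + b := by push_cast at hi; linarith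
        have hb : ((b' : ℤ) - b) * ((m₂ : ℤ) - m₁) = 0 := by
          push_cast at hj
          have : (a' : ℤ) = a + b - b' := by linarith
          rw [this] at hj
          linarith
        rcases mul_eq_zero.mp hb with hb | hb
        · omega
        · omega
      · exact (h'.1 (by
          convert hS.add (isMonomialDegree_of_exponents i 0 0 0) using 1
          · push_cast at *; linarith
          · push_cast at *; linarith)).elim
    · exact (h'.2 (by
          convert hS.add (isMonomialDegree_of_exponents i 0 0 j) using 1
          · push_cast at *; linarith
          · push_cast at *; linarith)).elim
  · obtain ⟨i, hi⟩ := Int.le.dest hlt.le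
    rcases j with _ | j
    · rcases i with _ | i
      · push_cast at hi; omega
      · exact (h.1 (by
          convert hS'.add (isMonomialDegree_of_exponents i 0 0 0) using 1
          · push_cast at *; linarith
          · push_cast at *; linarith)).elim
    -- Here x₀^i x₁^a' x₂^b' = x₁^a x₂^b x₃^(j+1). Saturation makes x₁^a' x₂^b' divisible by
    -- x₃^(j+1), contrary to its being standard.
    · refine (h'.2 ?_).elim
      have := IsMonomialDegree.of_add_left_of_add_right hsat i (j + 1)
        (D := (a' : ℤ) + b' - (j + 1)) (W := a * m₁ + b * m₂) ?_ ?_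
      · convert this.add (isMonomialDegree_of_exponents 0 0 0 j) using 1
        · push_cast at *; linarith
        · push_cast at *; linarith
      · convert hS using 1
        · push_cast at *; linarith
        · push_cast at *; linarith
      · convert hS' using 1
        · push_cast at *; linarith
        · push_cast at *; linarith

theorem IsStandardExponent.eq_of_dvd
    (hsat : ∀ D W : ℤ, IsMonomialDegree m₁ m₂ m₃ (D + 1) W →
      IsMonomialDegree m₁ m₂ m₃ (D + 1) (W + m₃) → IsMonomialDegree m₁ m₂ m₃ D W)
    (h₁₂ : m₁ < m₂) {a b a' b' : ℕ}
    (h : IsStandardExponent m₁ m₂ m₃ a b) (h' : IsStandardExponent m₁ m₂ m₃ a' b')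
    (hd : (m₃ : ℤ) ∣ ((a' : ℤ) - a) * m₁ + ((b' : ℤ) - b) * m₂) : a = a' ∧ b = b' := by
  obtain ⟨k, hk⟩ := hd
  obtain ⟨j, rfl | rfl⟩ := Int.eq_nat_or_neg k
  · exact h.eq_of_le hsat h₁₂ h' j (by linarith)
  · have := h'.eq_of_le hsat h₁₂ h j (by linarith)
    exact ⟨this.1.symm, this.2.symm⟩

/-- Exponents of two binomials `x₁^α - x₂^c x₀^p x₃^q` and `x₂^β - x₁^d x₀^p' x₃^q'` that vanish on
the curve and whose exponent vectors generate the lattice of all relations modulo `m₃`. -/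
structure BinomialExponents (m₁ m₂ m₃ α β c d p q p' q' : ℕ) : Prop where
  c_lt : c < β
  d_lt : d < α
  weight_fst : α * m₁ = c * m₂ + q * m₃
  degree_fst : α = c + p + q
  weight_snd : β * m₂ = d * m₁ + q' * m₃
  degree_snd : β = d + p' + q'
  generate : ∀ a b : ℤ, (m₃ : ℤ) ∣ a * m₁ + b * m₂ →
    ∃ r s : ℤ, a = r * α - s * d ∧ b = s * β - r * c

-- α and β are the least nonstandard pure powers. The only other possible minimal nonstandard
-- exponent is (α - d, β - c), the sum of the two relation vectors, so reduction to standard form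
-- stays within the lattice they generate.
set_option maxHeartbeats 1000000 in
theorem exists_binomialExponents
    (hsat : ∀ D W : ℤ, IsMonomialDegree m₁ m₂ m₃ (D + 1) W →
      IsMonomialDegree m₁ m₂ m₃ (D + 1) (W + m₃) → IsMonomialDegree m₁ m₂ m₃ D W)
    (h₁₂ : m₁ < m₂) (h₂₃ : m₂ < m₃) :
    ∃ α β c d p q p' q' : ℕ, BinomialExponents m₁ m₂ m₃ α β c d p q p' q' := by
  classical
  have key := @IsStandardExponent.eq_of_dvd m₁ m₂ m₃ hsat h₁₂
  have hα : ∃ α, ¬ IsStandardExponent m₁ m₂ m₃ α 0 := by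
    -- On the curve x₁^m₃ = x₀^(m₃-m₁) x₃^m₁.
    refine ⟨m₃, fun h => h.1 ⟨m₃ - m₁ - 1, 0, 0, m₁, ?_, ?_⟩⟩
    · push_cast [Nat.sub_sub, Nat.cast_sub (show m₁ + 1 ≤ m₃ by omega)]; ring
    · push_cast; ring
  have hβ : ∃ β, ¬ IsStandardExponent m₁ m₂ m₃ 0 β := by
    refine ⟨m₃, fun h => h.1 ⟨m₃ - m₂ - 1, 0, 0, m₂, ?_, ?_⟩⟩
    · push_cast [Nat.sub_sub, Nat.cast_sub (show m₂ + 1 ≤ m₃ by omega)]; ring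
    · push_cast; ring
  obtain ⟨α, hα, hαmin⟩ : ∃ α, ¬ IsStandardExponent m₁ m₂ m₃ α 0 ∧
      ∀ a < α, IsStandardExponent m₁ m₂ m₃ a 0 :=
    ⟨Nat.find hα, Nat.find_spec hα, fun a ha => not_not.mp (Nat.find_min hα ha)⟩
  obtain ⟨β, hβ, hβmin⟩ : ∃ β, ¬ IsStandardExponent m₁ m₂ m₃ 0 β ∧
      ∀ b < β, IsStandardExponent m₁ m₂ m₃ 0 b :=
    ⟨Nat.find hβ, Nat.find_spec hβ, fun a ha => not_not.mp (Nat.find_min hβ ha)⟩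
  have hα0 : 0 < α := by
    rcases Nat.eq_zero_or_pos α with rfl | h
    · exact (hα isStandardExponent_zero).elim
    · exact h
  have hβ0 : 0 < β := by
    rcases Nat.eq_zero_or_pos β with rfl | h
    · exact (hβ isStandardExponent_zero).elim
    · exact h
  obtain ⟨c', c, p, q, hc, hDc, hWc⟩ := exists_isStandardExponent (m₁ := m₁) (m₂ := m₂) (m₃ := m₃)
    α 0
  obtain ⟨d, d', p', q', hd, hDd, hWd⟩ :=
    exists_isStandardExponent (m₁ := m₁) (m₂ := m₂) (m₃ := m₃) 0 β
  -- If x₁ occurred in the standard form of x₁^α, cancelling it would leave two standard monomials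
  -- congruent modulo m₃, hence equal, making x₁^α standard.
  obtain rfl : c' = 0 := by
    by_contra hne
    have := key (hαmin (α - 1) (by omega)) (hc.mono (Nat.sub_le c' 1) le_rfl) ⟨-q, by
      zify at hWc
      push_cast [Nat.cast_sub (show 1 ≤ c' by omega), Nat.cast_sub (show 1 ≤ α by omega)] at *
      linarith⟩
    apply hα
    rwa [show α = c' by omega, this.2]
  obtain rfl : d' = 0 := by
    by_contra hne
    have := key (hβmin (β - 1) (by omega)) (hd.mono le_rfl (Nat.sub_le d' 1)) ⟨-q', by
      zify at hWd
      push_cast [Nat.cast_sub (show 1 ≤ d' by omega), Nat.cast_sub (show 1 ≤ β by omega)] at *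
      linarith⟩
    apply hβ
    rwa [show β = d' by omega, this.1]
  have hcβ : c < β := by
    by_contra h
    exact hβ (hc.mono le_rfl (by omega))
  have hdα : d < α := by
    by_contra h
    exact hα (hd.mono (by omega) le_rfl)
  have hWc' : (α : ℤ) * m₁ = c * m₂ + q * m₃ := by exact_mod_cast (by simpa using hWc)
  have hWd' : (β : ℤ) * m₂ = d * m₁ + q' * m₃ := by exact_mod_cast (by simpa using hWd)
  have hmin : ∀ γ δ : ℕ, ¬ IsStandardExponent m₁ m₂ m₃ γ δ →
      (∀ a b, a ≤ γ → b ≤ δ → a + b < γ + δ → IsStandardExponent m₁ m₂ m₃ a b) →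
      0 < γ → 0 < δ → γ = α - d ∧ δ = β - c := by
    intro γ δ hn hlow hγ hδ
    obtain ⟨e, f, i, j, hs, hD, hW⟩ :=
      exists_isStandardExponent (m₁ := m₁) (m₂ := m₂) (m₃ := m₃) γ δ
    zify at hW
    obtain rfl : e = 0 := by
      by_contra hne
      have := key (hlow (γ - 1) δ (by omega) le_rfl (by omega))
        (hs.mono (Nat.sub_le e 1) le_rfl) ⟨-j, by
          push_cast [Nat.cast_sub (show 1 ≤ e by omega), Nat.cast_sub (show 1 ≤ γ by omega)]
          linarith⟩
      apply hn
      rwa [show γ = e by omega, this.2]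
    obtain rfl : f = 0 := by
      by_contra hne
      have := key (hlow γ (δ - 1) le_rfl (by omega) (by omega))
        (hs.mono le_rfl (Nat.sub_le f 1)) ⟨-j, by
          push_cast [Nat.cast_sub (show 1 ≤ f by omega), Nat.cast_sub (show 1 ≤ δ by omega)] at hW ⊢
          linarith⟩
      apply hn
      rwa [show δ = f by omega, this.1]
    have hγα : γ < α := by
      by_contra h
      exact hα (hlow α 0 (by omega) (by omega) (by omega))
    have hδβ : δ < β := by
      by_contra h
      exact hβ (hlow 0 β (by omega) (by omega) (by omega))
    -- By now x₁^γ x₂^δ reduces to x₀^i x₃^j, so x₁^(α-γ) and x₂^(c+δ) have congruent weights and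
    -- cannot both be standard.
    have h1 : β ≤ c + δ := by
      by_contra h
      have := key (hαmin (α - γ) (by omega)) (hβmin (c + δ) (by omega)) ⟨j - q, by
        push_cast [Nat.cast_sub hγα.le] at *
        linarith⟩
      omega
    have h2 : α ≤ d + γ := by
      by_contra h
      have := key (hβmin (β - δ) (by omega)) (hαmin (d + γ) (by omega)) ⟨j - q', by
        push_cast [Nat.cast_sub hδβ.le] at *
        linarith⟩
      omega
    -- Otherwise (α - d, β - c) lies strictly below (γ, δ), hence is standard; its weight is 0
    -- modulo m₃, so it would be (0, 0).
    by_contra hne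
    have := key isStandardExponent_zero (hlow (α - d) (β - c) (by omega) (by omega) (by omega))
      ⟨q + q', by
        push_cast [Nat.cast_sub hdα.le, Nat.cast_sub hcβ.le]
        linarith⟩
    omega
  have hred : ∀ n a b : ℕ, a + b = n → ∃ e f : ℕ, IsStandardExponent m₁ m₂ m₃ e f ∧
      ∃ r s : ℤ, (a : ℤ) - e = r * α - s * d ∧ (b : ℤ) - f = s * β - r * c := by
    intro n
    induction n using Nat.strong_induction_on with
    | _ n ih =>
    rintro a b rfl
    by_cases hM : IsStandardExponent m₁ m₂ m₃ a b
    · exact ⟨a, b, hM, 0, 0, by simp, by simp⟩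
    -- This and d < β make each reduction lower the total exponent, as the induction needs.
    have hcα : c < α := by
      by_contra h
      obtain rfl : α = c := by omega
      have : q = 0 := by omega
      subst this
      have : (α : ℤ) * ((m₂ : ℤ) - m₁) = 0 := by push_cast at hWc'; linarith
      rcases mul_eq_zero.mp this with h | h <;> omega
    have hdβ : d < β := by
      by_contra h
      obtain rfl : β = d := by omega
      have : q' = 0 := by omega
      subst this
      have : (β : ℤ) * ((m₂ : ℤ) - m₁) = 0 := by push_cast at hWd'; linarith
      rcases mul_eq_zero.mp this with h | h <;> omega
    have hex : ∃ k, ∃ γ δ : ℕ, γ + δ = k ∧ γ ≤ a ∧ δ ≤ b ∧ ¬ IsStandardExponent m₁ m₂ m₃ γ δ :=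
      ⟨_, a, b, rfl, le_rfl, le_rfl, hM⟩
    obtain ⟨γ, δ, hk, hγa, hδb, hn⟩ := Nat.find_spec hex
    have hlow : ∀ a b, a ≤ γ → b ≤ δ → a + b < γ + δ → IsStandardExponent m₁ m₂ m₃ a b := by
      intro a' b' ha' hb' hlt
      by_contra hc
      exact Nat.find_min hex (m := a' + b') (by omega)
        ⟨a', b', rfl, by omega, by omega, hc⟩
    rcases Nat.eq_zero_or_pos δ with rfl | hδ
    · have : α ≤ γ := by
        by_contra h
        exact hn (hαmin γ (by omega))
      obtain ⟨e, f, hs, r, s, h1, h2⟩ := ih _ (by omega) (a - α) (b + c) rfl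
      refine ⟨e, f, hs, r + 1, s, ?_, ?_⟩
      · push_cast [Nat.cast_sub (show α ≤ a by omega)] at h1; linarith
      · push_cast at h2; linarith
    rcases Nat.eq_zero_or_pos γ with rfl | hγ
    · have : β ≤ δ := by
        by_contra h
        exact hn (hβmin δ (by omega))
      obtain ⟨e, f, hs, r, s, h1, h2⟩ := ih _ (by omega) (a + d) (b - β) rfl
      refine ⟨e, f, hs, r, s + 1, ?_, ?_⟩
      · push_cast at h1; linarith
      · push_cast [Nat.cast_sub (show β ≤ b by omega)] at h2; linarith
    obtain ⟨rfl, rfl⟩ := hmin γ δ hn hlow hγ hδ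
    obtain ⟨e, f, hs, r, s, h1, h2⟩ := ih _ (by omega) (a - (α - d)) (b - (β - c)) rfl
    refine ⟨e, f, hs, r + 1, s + 1, ?_, ?_⟩
    · push_cast [Nat.cast_sub hγa, Nat.cast_sub hdα.le] at h1; linarith
    · push_cast [Nat.cast_sub hδb, Nat.cast_sub hcβ.le] at h2; linarith
  refine ⟨α, β, c, d, p, q, p', q', hcβ, hdα, by exact_mod_cast hWc', by omega,
    by exact_mod_cast hWd', by omega, ?_⟩
  intro a b hab
  -- Translating by N (α - d, β - c), a lattice vector with positive entries, makes both coordinates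
  -- nonnegative.
  set N : ℤ := |a| + |b| with hN
  have ha0 : 0 ≤ a + N * (α - d) := by
    have h1 : (1 : ℤ) ≤ α - d := by omega
    have h2 := neg_abs_le a
    have h3 := abs_nonneg a
    have h4 := abs_nonneg b
    nlinarith
  have hb0 : 0 ≤ b + N * (β - c) := by
    have h1 : (1 : ℤ) ≤ β - c := by omega
    have h2 := neg_abs_le b
    have h3 := abs_nonneg a
    have h4 := abs_nonneg b
    nlinarith
  obtain ⟨a', ha'⟩ := Int.eq_ofNat_of_zero_le ha0
  obtain ⟨b', hb'⟩ := Int.eq_ofNat_of_zero_le hb0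
  obtain ⟨e, f, hs, r, s, h1, h2⟩ := hred _ a' b' rfl
  obtain ⟨k, hk⟩ := hab
  have := key isStandardExponent_zero hs ⟨k + N * (q + q') - r * q - s * q', by
    have he : (e : ℤ) = a + N * (α - d) - (r * α - s * d) := by linarith
    have hf : (f : ℤ) = b + N * (β - c) - (s * β - r * c) := by linarith
    rw [he, hf]
    push_cast
    linear_combination hk + (N - r) * hWc' + (N - s) * hWd'⟩
  obtain ⟨rfl, rfl⟩ := this
  refine ⟨r - N, s - N, ?_, ?_⟩
  · push_cast at h1; linarith
  · push_cast at h2; linarith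

end Semigroup

/-! ### The form G obtained from a power of the second binomial. -/

section Equations

variable {R S : Type*} [CommRing R] [CommRing S]

/-- The binomial `x₁^α - x₂^c x₀^p x₃^q`. -/
def binomialForm (α c p q : ℕ) (x₀ x₁ x₂ x₃ : R) : R :=
  x₁ ^ α - x₂ ^ c * (x₀ ^ p * x₃ ^ q)

/-- The remainder of `(x₂^β - x₁^d x₀^p' x₃^q')^α` on division by `x₁^α - x₂^c x₀^p x₃^q`,
divided by `x₂^(c d)`. -/
def reducedPower (α β c d p q p' q' : ℕ) (x₀ x₁ x₂ x₃ : R) : R :=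
  ∑ k ∈ Finset.range (α + 1), (-1) ^ k * (α.choose k : R) *
    (x₂ ^ (β * (α - k) + c * (d * k / α) - c * d) * x₁ ^ (d * k % α) *
      (x₀ ^ p * x₃ ^ q) ^ (d * k / α) * (x₀ ^ p' * x₃ ^ q') ^ k)

theorem map_binomialForm {F : Type*} [FunLike F R S] [RingHomClass F R S] (f : F) (α c p q : ℕ)
    (x₀ x₁ x₂ x₃ : R) :
    f (binomialForm α c p q x₀ x₁ x₂ x₃) = binomialForm α c p q (f x₀) (f x₁) (f x₂) (f x₃) := by
  simp [binomialForm]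

theorem map_reducedPower {F : Type*} [FunLike F R S] [RingHomClass F R S] (f : F)
    (α β c d p q p' q' : ℕ) (x₀ x₁ x₂ x₃ : R) :
    f (reducedPower α β c d p q p' q' x₀ x₁ x₂ x₃) =
      reducedPower α β c d p q p' q' (f x₀) (f x₁) (f x₂) (f x₃) := by
  simp [reducedPower]

/-- Over ℚ, dk/α = d - d(α-k)/α ≥ d - (α-k); the bound is an integer, so it survives the floor. -/
theorem le_sub_add_mul_div {α d k : ℕ} (hd : d < α) (hk : k ≤ α) :
    d ≤ (α - k) + d * k / α := by
  have hα : 0 < α := by omega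
  obtain ⟨j, rfl⟩ := Nat.exists_eq_add_of_le hk
  rw [Nat.add_sub_cancel_left]
  rcases le_total d j with h | h
  · exact h.trans (Nat.le_add_right _ _)
  · have : d - j ≤ d * k / (k + j) := by
      rw [Nat.le_div_iff_mul_le hα]
      zify [h]
      nlinarith
    omega

theorem mul_le_reducedPower_exponent {α β c d k : ℕ} (hc : c < β) (hd : d < α) (hk : k ≤ α) :
    c * d ≤ β * (α - k) + c * (d * k / α) := by
  have := Nat.mul_le_mul_left c (le_sub_add_mul_div hd hk)
  have := Nat.mul_le_mul_right (α - k) hc.le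
  rw [mul_add] at *
  omega

/-- Strictness for k < α means that only the term k = α of `reducedPower` survives at x₂ = 0. -/
theorem mul_lt_reducedPower_exponent {α β c d k : ℕ} (hc : c < β) (hd : d < α) (hk : k < α) :
    c * d < β * (α - k) + c * (d * k / α) := by
  have := Nat.mul_le_mul_left c (le_sub_add_mul_div hd hk.le)
  have := Nat.mul_lt_mul_of_pos_right hc (show 0 < α - k by omega)
  rw [mul_add] at *
  omega

theorem pow_mul_reducedPower {α β c d p q : ℕ} (p' q' : ℕ) (hc : c < β) (hd : d < α)
    {x₀ x₁ x₂ x₃ : R} (h : binomialForm α c p q x₀ x₁ x₂ x₃ = 0) :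
    x₂ ^ (c * d) * reducedPower α β c d p q p' q' x₀ x₁ x₂ x₃ =
      binomialForm β d p' q' x₀ x₂ x₁ x₃ ^ α := by
  rw [binomialForm, sub_eq_zero] at h
  rw [binomialForm, sub_eq_neg_add, add_pow, reducedPower, Finset.mul_sum]
  refine Finset.sum_congr rfl fun k hk => ?_
  have hk : k ≤ α := Nat.lt_succ_iff.mp (Finset.mem_range.mp hk)
  have e₂ : x₂ ^ (c * d) * x₂ ^ (β * (α - k) + c * (d * k / α) - c * d) =
      (x₂ ^ β) ^ (α - k) * (x₂ ^ c) ^ (d * k / α) := by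
    rw [← pow_add, Nat.add_sub_cancel' (mul_le_reducedPower_exponent hc hd hk), pow_add, pow_mul,
      pow_mul]
  -- Division of the exponent dk by α, using F = 0 to replace x₁^α.
  have e₁ : (x₁ ^ d) ^ k = x₁ ^ (d * k % α) * (x₂ ^ c * (x₀ ^ p * x₃ ^ q)) ^ (d * k / α) := by
    rw [← h, ← pow_mul, ← pow_mul, ← pow_add, Nat.mod_add_div]
  calc _ = (-1) ^ k * (α.choose k : R) *
        ((x₂ ^ (c * d) * x₂ ^ (β * (α - k) + c * (d * k / α) - c * d)) * x₁ ^ (d * k % α) *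
          (x₀ ^ p * x₃ ^ q) ^ (d * k / α) * (x₀ ^ p' * x₃ ^ q') ^ k) := by ring
    _ = (-1) ^ k * (α.choose k : R) * ((x₂ ^ β) ^ (α - k) * (x₁ ^ (d * k % α) *
          (x₂ ^ c * (x₀ ^ p * x₃ ^ q)) ^ (d * k / α)) * (x₀ ^ p' * x₃ ^ q') ^ k) := by
      rw [e₂, mul_pow (x₂ ^ c)]; ring
    _ = _ := by rw [← e₁, neg_pow, mul_pow]; ring

theorem reducedPower_of_eq_zero {α β c d : ℕ} (p q p' q' : ℕ) (hc : c < β) (hd : d < α)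
    (x₀ x₁ x₃ : R) :
    reducedPower α β c d p q p' q' x₀ x₁ 0 x₃ =
      (-1) ^ α * ((x₀ ^ p * x₃ ^ q) ^ d * (x₀ ^ p' * x₃ ^ q') ^ α) := by
  have hα : 0 < α := by omega
  rw [reducedPower, Finset.sum_range_succ, Finset.sum_eq_zero]
  · simp [Nat.mul_div_cancel _ hα]
  · intro k hk
    have := mul_lt_reducedPower_exponent hc hd (Finset.mem_range.mp hk)
    rw [zero_pow (by omega)]
    simp

theorem reducedPower_of_outer_eq_zero {α β c d p' q' : ℕ} (p q : ℕ) (h : p' + q' ≠ 0)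
    (x₁ x₂ : R) :
    reducedPower α β c d p q p' q' 0 x₁ x₂ 0 = x₂ ^ (β * α - c * d) := by
  have hB : (0 : R) ^ p' * 0 ^ q' = 0 := by
    rw [← pow_add, zero_pow h]
  rw [reducedPower, Finset.sum_eq_single 0]
  · simp
  · intro k _ hk
    rw [hB, zero_pow hk]
    simp
  · simp

end Equations

/-! ### Solutions of F = G = 0 in ℙ³. -/

namespace BinomialExponents

variable {m₁ m₂ m₃ α β c d p q p' q' : ℕ}

theorem add_ne_zero_fst (h : BinomialExponents m₁ m₂ m₃ α β c d p q p' q') (h₁₂ : m₁ < m₂) :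
    p + q ≠ 0 := by
  intro h0
  have h1 := h.weight_fst
  have h2 := h.degree_fst
  have h3 := h.d_lt
  obtain ⟨rfl, rfl⟩ : p = 0 ∧ q = 0 := by omega
  obtain rfl : α = c := by omega
  have := Nat.mul_lt_mul_of_pos_left h₁₂ (show 0 < α by omega)
  omega

theorem add_ne_zero_snd (h : BinomialExponents m₁ m₂ m₃ α β c d p q p' q') (h₁₂ : m₁ < m₂) :
    p' + q' ≠ 0 := by
  intro h0
  have h1 := h.weight_snd
  have h2 := h.degree_snd
  have h3 := h.c_lt
  obtain ⟨rfl, rfl⟩ : p' = 0 ∧ q' = 0 := by omega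
  obtain rfl : β = d := by omega
  have := Nat.mul_lt_mul_of_pos_left h₁₂ (show 0 < β by omega)
  omega

theorem exponent_pos (h : BinomialExponents m₁ m₂ m₃ α β c d p q p' q') :
    0 < β * α - c * d :=
  Nat.sub_pos_of_lt (Nat.mul_lt_mul'' h.c_lt h.d_lt)

variable {K : Type*} [Field K]

theorem eq_zero_of_outer_eq_zero (h : BinomialExponents m₁ m₂ m₃ α β c d p q p' q')
    (h₁₂ : m₁ < m₂) {x₁ x₂ : K}
    (hF : binomialForm α c p q 0 x₁ x₂ 0 = 0)
    (hG : reducedPower α β c d p q p' q' 0 x₁ x₂ 0 = 0) : x₁ = 0 ∧ x₂ = 0 := by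
  rw [reducedPower_of_outer_eq_zero p q (h.add_ne_zero_snd h₁₂)] at hG
  rw [binomialForm, ← pow_add, zero_pow (h.add_ne_zero_fst h₁₂), mul_zero, sub_zero] at hF
  exact ⟨eq_zero_of_pow_eq_zero hF, eq_zero_of_pow_eq_zero hG⟩

/-- Every Laurent monomial of weight 0 is a product of powers of the two binomial relations; the
exponent of x₃ is then forced because m₃ ≠ 0. -/
theorem zpow_eq_one (h : BinomialExponents m₁ m₂ m₃ α β c d p q p' q') (h₃ : 0 < m₃)
    {x₁ x₂ x₃ : K} (hx₁ : x₁ ≠ 0) (hx₂ : x₂ ≠ 0) (hx₃ : x₃ ≠ 0)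
    (h1 : x₁ ^ α = x₂ ^ c * x₃ ^ q) (h2 : x₂ ^ β = x₁ ^ d * x₃ ^ q') (a b j : ℤ)
    (hab : a * m₁ + b * m₂ + j * m₃ = 0) : x₁ ^ a * x₂ ^ b * x₃ ^ j = 1 := by
  obtain ⟨r, s, rfl, rfl⟩ := h.generate a b ⟨-j, by linarith⟩
  have hw₁ : (α : ℤ) * m₁ = c * m₂ + q * m₃ := by exact_mod_cast h.weight_fst
  have hw₂ : (β : ℤ) * m₂ = d * m₁ + q' * m₃ := by exact_mod_cast h.weight_snd
  have hj : j = -(r * q) - s * q' := by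
    have : (j + r * q + s * q') * (m₃ : ℤ) = 0 := by
      linear_combination hab - r * hw₁ - s * hw₂
    have := (mul_eq_zero.mp this).resolve_right (by omega)
    linarith
  have e1 : (x₁ ^ (α : ℤ)) ^ r = (x₂ ^ (c : ℤ) * x₃ ^ (q : ℤ)) ^ r := by
    rw [zpow_natCast, zpow_natCast, zpow_natCast, h1]
  have e2 : (x₂ ^ (β : ℤ)) ^ s = (x₁ ^ (d : ℤ) * x₃ ^ (q' : ℤ)) ^ s := by
    rw [zpow_natCast, zpow_natCast, zpow_natCast, h2]
  rw [mul_zpow, ← zpow_mul, ← zpow_mul, ← zpow_mul] at e1 e2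
  rw [hj, zpow_sub₀ hx₁, zpow_sub₀ hx₂, zpow_sub₀ hx₃, zpow_neg, mul_comm r, mul_comm s,
    mul_comm s, mul_comm r, mul_comm r, mul_comm s, e1, e2]
  have := zpow_ne_zero (d * s : ℤ) hx₁
  have := zpow_ne_zero (c * r : ℤ) hx₂
  have := zpow_ne_zero (q * r : ℤ) hx₃
  have := zpow_ne_zero (q' * s : ℤ) hx₃
  field_simp

theorem exists_parameter (h : BinomialExponents m₁ m₂ m₃ α β c d p q p' q')
    (h₁ : 0 < m₁) (h₂ : 0 < m₂) (h₃ : 0 < m₃) (hgcd : Nat.gcd m₁ (Nat.gcd m₂ m₃) = 1)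
    {x₁ x₂ x₃ : K} (hF : binomialForm α c p q 1 x₁ x₂ x₃ = 0)
    (hG : reducedPower α β c d p q p' q' 1 x₁ x₂ x₃ = 0) :
    ∃ t : K, x₁ = t ^ m₁ ∧ x₂ = t ^ m₂ ∧ x₃ = t ^ m₃ := by
  have hα : α ≠ 0 := by have := h.d_lt; omega
  have hβ : β ≠ 0 := by have := h.c_lt; omega
  have hf : binomialForm β d p' q' 1 x₂ x₁ x₃ = 0 := by
    have := pow_mul_reducedPower p' q' h.c_lt h.d_lt hF
    rw [hG, mul_zero] at this
    exact eq_zero_of_pow_eq_zero this.symm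
  have h1 : x₁ ^ α = x₂ ^ c * x₃ ^ q := by
    simpa [binomialForm, sub_eq_zero] using hF
  have h2 : x₂ ^ β = x₁ ^ d * x₃ ^ q' := by
    simpa [binomialForm, sub_eq_zero] using hf
  by_cases hx₃ : x₃ = 0
  · subst hx₃
    -- The weight equations exclude q = q' = 0, since c < β and d < α; whichever variable vanishes
    -- first then forces the other.
    have hx₁₂ : x₁ = 0 ∧ x₂ = 0 := by
      by_cases hq : q = 0
      · have hq' : q' ≠ 0 := by
          rintro rfl
          have e1 := h.weight_fst
          have e2 := h.weight_snd
          subst hq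
          have := Nat.mul_lt_mul_of_pos_right h.c_lt h₂
          have := Nat.mul_lt_mul_of_pos_right h.d_lt h₁
          omega
        have hx₂ : x₂ = 0 := by
          rw [zero_pow hq', mul_zero] at h2
          exact eq_zero_of_pow_eq_zero h2
        have hc : c ≠ 0 := by
          rintro rfl
          have e1 := h.weight_fst
          subst hq
          have := Nat.mul_pos (Nat.pos_of_ne_zero hα) h₁
          omega
        rw [hx₂, zero_pow hc, zero_mul] at h1
        exact ⟨eq_zero_of_pow_eq_zero h1, hx₂⟩
      · have hx₁ : x₁ = 0 := by
          rw [zero_pow hq, mul_zero] at h1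
          exact eq_zero_of_pow_eq_zero h1
        refine ⟨hx₁, ?_⟩
        by_cases hd : d = 0
        · have hq' : q' ≠ 0 := by
            rintro rfl
            have e2 := h.weight_snd
            subst hd
            have := Nat.mul_pos (Nat.pos_of_ne_zero hβ) h₂
            omega
          rw [zero_pow hq', mul_zero] at h2
          exact eq_zero_of_pow_eq_zero h2
        · rw [hx₁, zero_pow hd, zero_mul] at h2
          exact eq_zero_of_pow_eq_zero h2
    refine ⟨0, ?_, ?_, ?_⟩
    · rw [hx₁₂.1, zero_pow h₁.ne']
    · rw [hx₁₂.2, zero_pow h₂.ne']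
    · rw [zero_pow h₃.ne']
  -- At x₂ = 0 and x₀ = 1, G is up to sign a power of x₃.
  · have hx₂ : x₂ ≠ 0 := by
      rintro rfl
      rw [reducedPower_of_eq_zero p q p' q' h.c_lt h.d_lt] at hG
      simp [hx₃] at hG
    have hx₁ : x₁ ≠ 0 := by
      rintro rfl
      rw [zero_pow hα] at h1
      exact mul_ne_zero (pow_ne_zero c hx₂) (pow_ne_zero q hx₃) h1.symm
    obtain ⟨a, b, j, hab⟩ : ∃ a b j : ℤ, a * m₁ + b * m₂ + j * m₃ = 1 := by
      have e1 := Nat.gcd_eq_gcd_ab m₁ (Nat.gcd m₂ m₃)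
      have e2 := Nat.gcd_eq_gcd_ab m₂ m₃
      rw [hgcd] at e1
      refine ⟨Nat.gcdA m₁ (Nat.gcd m₂ m₃), Nat.gcdA m₂ m₃ * Nat.gcdB m₁ (Nat.gcd m₂ m₃),
        Nat.gcdB m₂ m₃ * Nat.gcdB m₁ (Nat.gcd m₂ m₃), ?_⟩
      rw [e2] at e1
      push_cast at e1
      linarith
    have key := h.zpow_eq_one h₃ hx₁ hx₂ hx₃ h1 h2
    have hpow : ∀ n : ℕ, (x₁ ^ a * x₂ ^ b * x₃ ^ j) ^ n =
        x₁ ^ (a * n) * x₂ ^ (b * n) * x₃ ^ (j * n) := by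
      intro n
      rw [mul_pow, mul_pow, ← zpow_natCast, ← zpow_natCast, ← zpow_natCast, ← zpow_mul,
        ← zpow_mul, ← zpow_mul]
    -- The Bézout monomial of weight 1 recovers the parameter.
    refine ⟨x₁ ^ a * x₂ ^ b * x₃ ^ j, ?_, ?_, ?_⟩
    · have := key (a * m₁ - 1) (b * m₁) (j * m₁) (by linear_combination (m₁ : ℤ) * hab)
      rw [zpow_sub_one₀ hx₁] at this
      rw [hpow]
      field_simp at this
      exact this.symm
    · have := key (a * m₂) (b * m₂ - 1) (j * m₂) (by linear_combination (m₂ : ℤ) * hab)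
      rw [zpow_sub_one₀ hx₂] at this
      rw [hpow]
      field_simp at this
      exact this.symm
    · have := key (a * m₃) (b * m₃) (j * m₃ - 1) (by linear_combination (m₃ : ℤ) * hab)
      rw [zpow_sub_one₀ hx₃] at this
      rw [hpow]
      field_simp at this
      exact this.symm

end BinomialExponents

/-! ### Divisibility in local domains of depth at least two. -/

section Depth

variable {T : Type*} [CommRing T] [IsDomain T]

theorem dvd_of_dvd_mul_of_dvd_mul {r₁ r₂ x f : T} (hx : x ≠ 0) (hr₁ : r₁ ≠ 0)
    (hr : ∀ a, r₁ ∣ r₂ * a → r₁ ∣ a) (h₁ : x ∣ r₁ * f) (h₂ : x ∣ r₂ * f) : x ∣ f := by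
  obtain ⟨a, ha⟩ := h₁
  obtain ⟨b, hb⟩ := h₂
  have hab : r₂ * a = r₁ * b := mul_left_cancel₀ hx (by linear_combination r₁ * hb - r₂ * ha)
  obtain ⟨a', rfl⟩ := hr a ⟨b, hab⟩
  exact ⟨a', mul_left_cancel₀ hr₁ (by linear_combination ha)⟩

theorem dvd_of_dvd_pow_mul_of_dvd_pow_mul {r₁ r₂ x : T} (hx : x ≠ 0) (hr₁ : r₁ ≠ 0)
    (hr : ∀ a, r₁ ∣ r₂ * a → r₁ ∣ a) (i j : ℕ) {f : T} (h₁ : x ∣ r₁ ^ i * f)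
    (h₂ : x ∣ r₂ ^ j * f) : x ∣ f := by
  induction i generalizing f j with
  | zero => simpa using h₁
  | succ i ih =>
    induction j generalizing f with
    | zero => simpa using h₂
    | succ j jh =>
      apply dvd_of_dvd_mul_of_dvd_mul hx hr₁ hr
      · refine ih (j + 1) (by rwa [← mul_assoc, ← pow_succ]) ?_
        rw [mul_left_comm]
        exact h₂.mul_left _
      · refine jh ?_ (by rwa [← mul_assoc, ← pow_succ])
        rw [mul_left_comm]
        exact h₁.mul_left _

/-- In a local domain of depth at least two, a quotient `f / x = f' / y` whose two denominators
generate an ideal primary to the maximal ideal belongs to the ring. -/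
theorem dvd_of_isRegular [IsLocalRing T] {rs : List T}
    (hrs : ∀ r ∈ rs, r ∈ IsLocalRing.maximalIdeal T)
    (hreg : RingTheory.Sequence.IsRegular T rs) (hlen : 2 ≤ rs.length) {x y f f' : T} (hx : x ≠ 0)
    (hmax : IsLocalRing.maximalIdeal T ≤ (Ideal.span {x, y}).radical) (h : x * f' = y * f) :
    x ∣ f := by
  obtain ⟨r₁, r₂, rs, rfl⟩ : ∃ r₁ r₂ rs', rs = r₁ :: r₂ :: rs' := by
    match rs, hlen with
    | r₁ :: r₂ :: rs', _ => exact ⟨r₁, r₂, rs', rfl⟩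
  have hw := hreg.toIsWeaklyRegular
  rw [RingTheory.Sequence.isWeaklyRegular_cons_iff,
    RingTheory.Sequence.isWeaklyRegular_cons_iff] at hw
  obtain ⟨h₁, h₂, -⟩ := hw
  have hr₁ : r₁ ≠ 0 := by
    rintro rfl
    exact one_ne_zero (h₁ (show (0 : T) • (1 : T) = (0 : T) • 0 by simp))
  have hr : ∀ a, r₁ ∣ r₂ * a → r₁ ∣ a := by
    intro a ha
    have hmem : ∀ b : T, (Submodule.Quotient.mk b : QuotSMulTop r₁ T) = 0 ↔ r₁ ∣ b := by
      intro b
      rw [Submodule.Quotient.mk_eq_zero, Submodule.mem_smul_pointwise_iff_exists]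
      constructor
      · rintro ⟨c, -, rfl⟩
        exact ⟨c, rfl⟩
      · rintro ⟨c, rfl⟩
        exact ⟨c, trivial, rfl⟩
    rw [← hmem] at ha ⊢
    apply h₂
    change r₂ • (Submodule.Quotient.mk a : QuotSMulTop r₁ T) = r₂ • 0
    rw [smul_zero, ← Submodule.Quotient.mk_smul]
    exact ha
  -- Writing r^n = a x + b y gives r^n f = x (a f + b f').
  have hann : ∀ r ∈ IsLocalRing.maximalIdeal T, ∃ n, x ∣ r ^ n * f := by
    intro r hr
    obtain ⟨n, hn⟩ := hmax hr
    obtain ⟨a, b, hab⟩ := Ideal.mem_span_pair.mp hn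
    exact ⟨n, a * f + b * f', by rw [← hab]; linear_combination (-b) * h⟩
  obtain ⟨i, hi⟩ := hann r₁ (hrs r₁ (by simp))
  obtain ⟨j, hj⟩ := hann r₂ (hrs r₂ (by simp))
  exact dvd_of_dvd_pow_mul_of_dvd_pow_mul hx hr₁ hr i j hi hj

end Depth

/-! ### The homogeneous ideal as the kernel of the parametrization. -/

section CoordinateRing

open MvPolynomial

variable {K : Type*} [Field K] {n : ℕ}

theorem genericZero_isHomogeneous {m : Fin n → ℕ}
    (hm : ∀ i, exponent m i ≤ exponent m (Fin.last n)) (i : Fin (n + 1)) :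
    (genericZero K m i).IsHomogeneous (exponent m (Fin.last n)) := by
  have := ((isHomogeneous_X K (0 : Fin 2)).pow (exponent m (Fin.last n) - exponent m i)).mul
    ((isHomogeneous_X K (1 : Fin 2)).pow (exponent m i))
  rwa [one_mul, one_mul, Nat.sub_add_cancel (hm i)] at this

theorem aeval_genericZero_homogeneousComponent {m : Fin n → ℕ}
    (hm : ∀ i, exponent m i ≤ exponent m (Fin.last n)) (hpos : 0 < exponent m (Fin.last n))
    (f : MvPolynomial (Fin (n + 1)) K) (k : ℕ) :
    aeval (genericZero K m) (homogeneousComponent k f) =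
      homogeneousComponent (exponent m (Fin.last n) * k) (aeval (genericZero K m) f) := by
  have hhom : ∀ j, (aeval (genericZero K m) (homogeneousComponent j f)).IsHomogeneous
      (exponent m (Fin.last n) * j) := fun j =>
    (homogeneousComponent_isHomogeneous j f).aeval _ (genericZero_isHomogeneous hm)
  conv_rhs => rw [← sum_homogeneousComponent f]
  rw [map_sum, map_sum]
  simp_rw [homogeneousComponent_of_mem (hhom _), mul_right_inj' hpos.ne']
  rw [Finset.sum_ite_eq]
  split_ifs with h
  · rfl
  · rw [homogeneousComponent_eq_zero _ _ (by simpa using h), map_zero]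

theorem eval_eval_genericZero (m : Fin n → ℕ) (u v : K) (f : MvPolynomial (Fin (n + 1)) K) :
    eval (fun i => u ^ (exponent m (Fin.last n) - exponent m i) * v ^ exponent m i) f =
      eval ![u, v] (aeval (genericZero K m) f) := by
  rw [← coe_aeval_eq_eval, ← coe_aeval_eq_eval, RingHom.coe_coe, RingHom.coe_coe,
    ← AlgHom.comp_apply]
  congr 1
  ext i
  simp [genericZero]

theorem mem_projMonomialCurve_of_rep_eq {m : Fin n → ℕ} {P : ProjSpace K n} (u v : K)
    (h : ∀ i, P.rep i = u ^ (exponent m (Fin.last n) - exponent m i) * v ^ exponent m i) :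
    P ∈ projMonomialCurve K m := by
  intro f hf
  rw [Set.mem_ofPred_eq] at hf
  rw [show P.rep = _ from funext h, eval_eval_genericZero, hf, map_zero]

theorem homogeneousVanishingIdeal_projMonomialCurve [IsAlgClosed K] {m : Fin n → ℕ}
    (hm : ∀ i, exponent m i ≤ exponent m (Fin.last n)) (hpos : 0 < exponent m (Fin.last n)) :
    homogeneousVanishingIdeal (projMonomialCurve K m) =
      RingHom.ker (aeval (genericZero K m)) := by
  apply le_antisymm
  · rw [homogeneousVanishingIdeal, Ideal.span_le]
    rintro f ⟨⟨d, hd⟩, hf⟩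
    rw [SetLike.mem_coe, RingHom.mem_ker]
    -- The factor `X 0` confines the check to u ≠ 0, where the parametrized vector is nonzero and
    -- defines a projective point.
    suffices X 0 * aeval (genericZero K m) f = 0 from
      (mul_eq_zero.mp this).resolve_left (X_ne_zero _)
    have : Infinite K := IsAlgClosed.instInfinite
    apply MvPolynomial.funext
    intro x
    rw [map_mul, eval_X, map_zero]
    by_cases hu : x 0 = 0
    · rw [hu, zero_mul]
    have hx : x = ![x 0, x 1] := by ext i; fin_cases i <;> rfl
    set w : Fin (n + 1) → K :=
      fun i => x 0 ^ (exponent m (Fin.last n) - exponent m i) * x 1 ^ exponent m i with hw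
    have hw0 : w ≠ 0 := by
      intro h
      have := congrFun h 0
      simp [hw, exponent, hu] at this
    obtain ⟨a, ha⟩ := Projectivization.exists_smul_eq_mk_rep K w hw0
    have hmem : Projectivization.mk K w hw0 ∈ projMonomialCurve K m := by
      -- The scalar relating the chosen representative to w is absorbed by rescaling (u, v) by its
      -- root of order mₙ.
      obtain ⟨b, hb⟩ := IsAlgClosed.exists_pow_nat_eq (a : K) hpos
      refine mem_projMonomialCurve_of_rep_eq (b * x 0) (b * x 1) fun i => ?_
      rw [← ha, Pi.smul_apply, Units.smul_def, smul_eq_mul, hw, ← hb, mul_pow, mul_pow]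
      nth_rw 1 [← Nat.sub_add_cancel (hm i)]
      rw [pow_add]
      ring
    have h0 := hf _ hmem
    rw [← ha] at h0
    have hsmul : eval (a • w) f = (a : K) ^ d * eval w f := by
      rw [eval_eq, eval_eq, Finset.mul_sum]
      refine Finset.sum_congr rfl fun s hs => ?_
      have : s.degree = d := by
        by_contra hne
        exact (mem_support_iff.mp hs) (hd.coeff_eq_zero hne)
      rw [← this, Finsupp.degree_apply, ← Finset.prod_pow_eq_pow_sum, mul_left_comm,
        ← Finset.prod_mul_distrib]
      simp [Units.smul_def, mul_pow]
    rw [hsmul] at h0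
    have := (mul_eq_zero.mp h0).resolve_left (pow_ne_zero _ a.ne_zero)
    rw [hw, eval_eval_genericZero, ← hx] at this
    rw [this, mul_zero]
  · intro f hf
    rw [RingHom.mem_ker] at hf
    rw [← sum_homogeneousComponent f]
    refine Ideal.sum_mem _ fun k _ => Ideal.subset_span
      ⟨⟨k, homogeneousComponent_isHomogeneous k f⟩, fun P hP => hP _ ?_⟩
    rw [Set.mem_ofPred_eq, aeval_genericZero_homogeneousComponent hm hpos]
    rw [show (aeval (genericZero K m)) f = 0 from hf, map_zero]

theorem monomial_eval_eq {R : Type*} [CommRing R] (u v : R) {m₁ m₂ m₃ N : ℕ} (h₁ : m₁ ≤ N)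
    (h₂ : m₂ ≤ N) (h₃ : m₃ ≤ N) (i a b j : ℕ) :
    (u ^ N) ^ i * (u ^ (N - m₁) * v ^ m₁) ^ a * (u ^ (N - m₂) * v ^ m₂) ^ b *
      (u ^ (N - m₃) * v ^ m₃) ^ j =
    u ^ (N * (i + a + b + j) - (a * m₁ + b * m₂ + j * m₃)) * v ^ (a * m₁ + b * m₂ + j * m₃) := by
  have e : N * (i + a + b + j) - (a * m₁ + b * m₂ + j * m₃) =
      N * i + (N - m₁) * a + (N - m₂) * b + (N - m₃) * j := by
    apply Nat.sub_eq_of_eq_add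
    zify [h₁, h₂, h₃]
    ring
  rw [e]
  ring

end CoordinateRing

/-! ### From Cohen–Macaulayness to saturation of the semigroup. -/

section Saturation

open MvPolynomial

variable {K : Type*} [Field K] {m₁ m₂ m₃ : ℕ}

theorem exponent_le_last (h₁₂ : m₁ < m₂) (h₂₃ : m₂ < m₃) (i : Fin 4) :
    exponent ![m₁, m₂, m₃] i ≤ exponent ![m₁, m₂, m₃] (Fin.last 3) := by
  change exponent ![m₁, m₂, m₃] i ≤ m₃
  fin_cases i
  · exact Nat.zero_le _
  · exact (h₁₂.trans h₂₃).le
  · exact h₂₃.le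
  · exact le_rfl

theorem genericZero_zero : genericZero K ![m₁, m₂, m₃] 0 = X 0 ^ m₃ := by
  change X 0 ^ (m₃ - 0) * X 1 ^ 0 = _
  simp

theorem genericZero_one :
    genericZero K ![m₁, m₂, m₃] 1 = X 0 ^ (m₃ - m₁) * X 1 ^ m₁ := rfl

theorem genericZero_two :
    genericZero K ![m₁, m₂, m₃] 2 = X 0 ^ (m₃ - m₂) * X 1 ^ m₂ := rfl

theorem genericZero_three : genericZero K ![m₁, m₂, m₃] 3 = X 1 ^ m₃ := by
  change X 0 ^ (m₃ - m₃) * X 1 ^ m₃ = _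
  simp

theorem aeval_genericZero_monomial (h₁₂ : m₁ < m₂) (h₂₃ : m₂ < m₃) (i a b j : ℕ) :
    aeval (genericZero K ![m₁, m₂, m₃])
      (X 0 ^ i * X 1 ^ a * X 2 ^ b * X 3 ^ j : MvPolynomial (Fin 4) K) =
      X 0 ^ (m₃ * (i + a + b + j) - (a * m₁ + b * m₂ + j * m₃)) *
        X 1 ^ (a * m₁ + b * m₂ + j * m₃) := by
  rw [← monomial_eval_eq (X 0) (X 1) (h₁₂.trans h₂₃).le h₂₃.le le_rfl]
  simp [genericZero_zero, genericZero_one, genericZero_two, genericZero_three]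

theorem isMonomialDegree_of_coeff_ne_zero (h₁₂ : m₁ < m₂) (h₂₃ : m₂ < m₃)
    (f : MvPolynomial (Fin 4) K) (e : Fin 2 →₀ ℕ)
    (he : coeff e (aeval (genericZero K ![m₁, m₂, m₃]) f) ≠ 0) :
    ∃ i a b j : ℕ, e 0 + e 1 = m₃ * (i + a + b + j) ∧ e 1 = a * m₁ + b * m₂ + j * m₃ := by
  have hX : ∀ k l : ℕ, (X 0 ^ k * X 1 ^ l : MvPolynomial (Fin 2) K) =
      monomial (Finsupp.single 0 k + Finsupp.single 1 l) 1 := by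
    intro k l
    rw [X_pow_eq_monomial, X_pow_eq_monomial, monomial_mul, one_mul]
  rw [f.as_sum, map_sum, coeff_sum] at he
  obtain ⟨s, -, hs⟩ := Finset.exists_ne_zero_of_sum_ne_zero he
  rw [monomial_eq, Finsupp.prod_fintype _ _ (by simp), Fin.prod_univ_four, map_mul,
    aeval_genericZero_monomial h₁₂ h₂₃, hX, algHom_C, algebraMap_eq, coeff_C_mul,
    coeff_monomial] at hs
  split_ifs at hs with h
  · refine ⟨s 0, s 1, s 2, s 3, ?_, ?_⟩
    · have hle : s 1 * m₁ + s 2 * m₂ + s 3 * m₃ ≤ m₃ * (s 0 + s 1 + s 2 + s 3) := by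
        have := Nat.mul_le_mul_left (s 1) (h₁₂.trans h₂₃).le
        have := Nat.mul_le_mul_left (s 2) h₂₃.le
        have := Nat.zero_le (m₃ * s 0)
        nlinarith
      rw [← h]
      simpa using Nat.sub_add_cancel hle
    · rw [← h]; simp
  · simp at hs

theorem sub_C_constantCoeff_mem {σ : Type*} {J : Ideal (MvPolynomial σ K)} (hJ : ∀ i, X i ∈ J)
    (p : MvPolynomial σ K) : p - C (constantCoeff p) ∈ J := by
  induction p using MvPolynomial.induction_on with
  | C a => simp
  | add p q hp hq =>
    convert J.add_mem hp hq using 1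
    simp only [map_add]
    ring
  | mul_X p i _ =>
    simpa using J.mul_mem_left p (hJ i)

theorem isMonomialDegree_of_isCohenMacaulayRing (h₁ : 0 < m₁) (h₁₂ : m₁ < m₂) (h₂₃ : m₂ < m₃)
    {R : Type*} [CommRing R] (hCM : IsCohenMacaulayRing R) (π : MvPolynomial (Fin 4) K →+* R)
    (hπ : Function.Surjective π) (ψ : R →+* MvPolynomial (Fin 2) K) (hψ : Function.Injective ψ)
    (hψπ : ∀ p, ψ (π p) = aeval (genericZero K ![m₁, m₂, m₃]) p) (D W : ℤ)
    (hD : IsMonomialDegree m₁ m₂ m₃ (D + 1) W)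
    (hW : IsMonomialDegree m₁ m₂ m₃ (D + 1) (W + m₃)) : IsMonomialDegree m₁ m₂ m₃ D W := by
  have h₃ : 0 < m₃ := by omega
  have : IsDomain R := hψ.isDomain ψ
  have hx₀ : ψ (π (X 0)) = X 0 ^ m₃ := by rw [hψπ, aeval_X, genericZero_zero]
  have hx₁ : ψ (π (X 1)) = X 0 ^ (m₃ - m₁) * X 1 ^ m₁ := by rw [hψπ, aeval_X, genericZero_one]
  have hx₂ : ψ (π (X 2)) = X 0 ^ (m₃ - m₂) * X 1 ^ m₂ := by rw [hψπ, aeval_X, genericZero_two]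
  have hx₃ : ψ (π (X 3)) = X 1 ^ m₃ := by rw [hψπ, aeval_X, genericZero_three]
  -- 𝔪 is the vertex of the affine cone and 𝔭 the line u = 0 on it; the chain 0 < 𝔭 < 𝔪 bounds the
  -- height, hence the depth, below by 2.
  set 𝔪 : Ideal R := RingHom.ker (constantCoeff.comp ψ) with h𝔪
  set 𝔭 : Ideal R := RingHom.ker
    ((aeval (![0, X 1] : Fin 2 → MvPolynomial (Fin 2) K)).toRingHom.comp ψ) with h𝔭
  have : 𝔪.IsPrime := RingHom.ker_isPrime _
  have : 𝔭.IsPrime := RingHom.ker_isPrime _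
  have hx₀ne : π (X 0) ≠ 0 := by
    intro h
    rw [h, map_zero] at hx₀
    exact pow_ne_zero _ (X_ne_zero _) hx₀.symm
  have hbot : (⊥ : Ideal R) < 𝔭 := by
    rw [bot_lt_iff_ne_bot]
    intro h
    refine hx₀ne ?_
    rw [← Ideal.mem_bot, ← h, h𝔭, RingHom.mem_ker]
    simp [hx₀, h₃.ne']
  have hlt : 𝔭 < 𝔪 := by
    refine lt_of_le_of_ne (fun r hr => ?_) fun h => ?_
    · have hc : ∀ g : MvPolynomial (Fin 2) K, constantCoeff g =
          constantCoeff (aeval (![0, X 1] : Fin 2 → MvPolynomial (Fin 2) K) g) := by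
        intro g
        induction g using MvPolynomial.induction_on with
        | C a => simp
        | add p q hp hq => simp [hp, hq]
        | mul_X p i _ => fin_cases i <;> simp
      rw [h𝔪, RingHom.mem_ker, RingHom.comp_apply, hc]
      rw [h𝔭, RingHom.mem_ker] at hr
      exact (congrArg constantCoeff hr).trans (map_zero _)
    · have : π (X 3) ∈ 𝔭 := by
        rw [h, h𝔪, RingHom.mem_ker]
        simp [hx₃, h₃.ne']
      rw [h𝔭, RingHom.mem_ker] at this
      simp [hx₃] at this
  have hheight : 2 ≤ 𝔪.height := by
    have e1 := Ideal.height_add_one_le_of_lt_of_isPrime hbot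
    have e2 := Ideal.height_add_one_le_of_lt_of_isPrime hlt
    calc (2 : ℕ∞) = 0 + 1 + 1 := by norm_num
      _ ≤ (⊥ : Ideal R).height + 1 + 1 := by gcongr; exact zero_le
      _ ≤ _ := (add_le_add_left e1 1).trans e2
  obtain ⟨-, rs, hrs, hreg, hlen⟩ := hCM.2 𝔪
  rw [IsLocalization.AtPrime.ringKrullDim_eq_height 𝔪] at hlen
  have hlen2 : 2 ≤ rs.length := by
    have hlen : (rs.length : ℕ∞) = 𝔪.height := by exact_mod_cast hlen
    rw [← hlen] at hheight
    exact_mod_cast hheight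
  have hle : 𝔪.primeCompl ≤ nonZeroDivisors R := 𝔪.primeCompl_le_nonZeroDivisors
  have : IsDomain (Localization.AtPrime 𝔪) := IsLocalization.isDomain_localization hle
  have hιinj : Function.Injective (algebraMap R (Localization.AtPrime 𝔪)) := IsLocalization.injective _ hle
  obtain ⟨i, a, b, j, hD, hW₁⟩ := hD
  obtain ⟨i', a', b', j', hD', hW₂⟩ := hW
  set f := π (X 0 ^ i * X 1 ^ a * X 2 ^ b * X 3 ^ j) with hf
  set f' := π (X 0 ^ i' * X 1 ^ a' * X 2 ^ b' * X 3 ^ j') with hf'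
  -- Both sides have bidegree (D + 2, W + m₃).
  have hff' : π (X 0) * f' = π (X 3) * f := by
    apply hψ
    have e : i' + 1 + a' + b' + j' = i + a + b + (j + 1) := by omega
    have e' : a' * m₁ + b' * m₂ + j' * m₃ = a * m₁ + b * m₂ + (j + 1) * m₃ := by
      zify
      linarith
    have h1 := aeval_genericZero_monomial (K := K) h₁₂ h₂₃ (i' + 1) a' b' j'
    have h2 := aeval_genericZero_monomial (K := K) h₁₂ h₂₃ i a b (j + 1)
    rw [e, e', ← h2] at h1
    rw [hf, hf', ← map_mul, ← map_mul, hψπ, hψπ]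
    convert h1 using 2 <;> ring
  have hpow : ∀ (k : ℕ) (r : R), k ≤ m₃ → ψ r = X 0 ^ (m₃ - k) * X 1 ^ k →
      r ^ m₃ = π (X 0) ^ (m₃ - k) * π (X 3) ^ k := by
    intro k r _ hr
    apply hψ
    rw [map_pow, map_mul, map_pow, map_pow, hr, hx₀, hx₃]
    ring
  have hrad : 𝔪 ≤ (Ideal.span {π (X 0), π (X 3)}).radical := by
    have m0 : π (X 0) ∈ Ideal.span {π (X 0), π (X 3)} := Ideal.subset_span (by simp)
    have m3 : π (X 3) ∈ Ideal.span {π (X 0), π (X 3)} := Ideal.subset_span (by simp)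
    intro r hr
    obtain ⟨p, rfl⟩ := hπ r
    have hX : ∀ k, X k ∈ ((Ideal.span {π (X 0), π (X 3)}).radical).comap π := by
      intro k
      rw [Ideal.mem_comap]
      fin_cases k
      · exact Ideal.le_radical m0
      · refine ⟨m₃, ?_⟩
        change π (X 1) ^ m₃ ∈ _
        rw [hpow m₁ _ (by omega) hx₁]
        exact Ideal.mul_mem_left _ _ (Ideal.pow_mem_of_mem _ m3 _ h₁)
      · refine ⟨m₃, ?_⟩
        change π (X 2) ^ m₃ ∈ _
        rw [hpow m₂ _ (by omega) hx₂]
        exact Ideal.mul_mem_left _ _ (Ideal.pow_mem_of_mem _ m3 _ (h₁.trans h₁₂))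
      · exact Ideal.le_radical m3
    have hX𝔪 : ∀ k, X k ∈ 𝔪.comap π := fun k => by
      rw [Ideal.mem_comap, ← Ideal.IsPrime.radical ‹𝔪.IsPrime›]
      refine Ideal.radical_mono ?_ (Ideal.mem_comap.mp (hX k))
      rw [Ideal.span_le]
      rintro _ (rfl | rfl)
      · rw [SetLike.mem_coe, h𝔪, RingHom.mem_ker]; simp [hx₀, h₃.ne']
      · rw [SetLike.mem_coe, h𝔪, RingHom.mem_ker]; simp [hx₃, h₃.ne']
    have h0 : constantCoeff p = 0 := by
      have h1 := (𝔪.comap π).sub_mem (Ideal.mem_comap.mpr hr) (sub_C_constantCoeff_mem hX𝔪 p)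
      rw [sub_sub_cancel, Ideal.mem_comap, h𝔪, RingHom.mem_ker, RingHom.comp_apply, hψπ] at h1
      simpa using h1
    have := sub_C_constantCoeff_mem hX p
    rwa [h0, C_0, sub_zero, Ideal.mem_comap] at this
  have hmax : IsLocalRing.maximalIdeal (Localization.AtPrime 𝔪) ≤
      (Ideal.span {algebraMap R (Localization.AtPrime 𝔪) (π (X 0)), algebraMap R (Localization.AtPrime 𝔪) (π (X 3))}).radical := by
    rw [← Localization.AtPrime.map_eq_maximalIdeal, Ideal.map_le_iff_le_comap,
      Ideal.comap_radical]
    refine hrad.trans (Ideal.radical_mono ?_)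
    rw [Ideal.span_le]
    rintro _ (rfl | rfl)
    · exact Ideal.mem_comap.mpr (Ideal.subset_span (by simp))
    · exact Ideal.mem_comap.mpr (Ideal.subset_span (by simp))
  obtain ⟨t, ht⟩ := dvd_of_isRegular hrs hreg hlen2
    (by rwa [ne_eq, map_eq_zero_iff _ hιinj]) hmax
    (show algebraMap R (Localization.AtPrime 𝔪) (π (X 0)) * algebraMap R (Localization.AtPrime 𝔪) f' = algebraMap R (Localization.AtPrime 𝔪) (π (X 3)) *
      algebraMap R (Localization.AtPrime 𝔪) f by
      rw [← map_mul (algebraMap R _), hff', map_mul])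
  obtain ⟨⟨t', s⟩, hs⟩ := IsLocalization.surj 𝔪.primeCompl t
  have hfs : f * s = π (X 0) * t' := by
    apply hιinj
    rw [map_mul, map_mul, ht, ← hs, mul_assoc]
  have hs0 : constantCoeff (ψ s) ≠ 0 := fun h => s.2 h
  obtain ⟨p, rfl⟩ := hπ t'
  have hfs' := congrArg ψ hfs
  set E : Fin 2 →₀ ℕ := Finsupp.single 0 (m₃ * (i + a + b + j) - (a * m₁ + b * m₂ + j * m₃)) +
    Finsupp.single 1 (a * m₁ + b * m₂ + j * m₃) with hE
  have hfE : ψ f = monomial E 1 := by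
    rw [hf, hψπ, aeval_genericZero_monomial h₁₂ h₂₃, X_pow_eq_monomial, X_pow_eq_monomial,
      monomial_mul, one_mul]
  rw [map_mul, map_mul, hfE, hx₀, hψπ, X_pow_eq_monomial] at hfs'
  -- As ψ s has nonzero constant term, the monomial E survives in ψ(f s) = u^m₃ ψ(t'); so E - (m₃,
  -- 0) occurs in ψ(t') and has bidegree (D, W).
  have hcoeff := congrArg (coeff E) hfs'
  rw [coeff_monomial_mul', coeff_monomial_mul', if_pos le_rfl, tsub_self, one_mul] at hcoeff
  split_ifs at hcoeff with hEle
  · rw [one_mul] at hcoeff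
    have hne : coeff (E - Finsupp.single 0 m₃)
        (aeval (genericZero K ![m₁, m₂, m₃]) p) ≠ 0 := by
      rw [← hcoeff]
      exact hs0
    obtain ⟨i₁, a₁, b₁, j₁, e1, e2⟩ := isMonomialDegree_of_coeff_ne_zero h₁₂ h₂₃ p _ hne
    have hE0 := hEle 0
    have hwle : a * m₁ + b * m₂ + j * m₃ ≤ m₃ * (i + a + b + j) := by
      have := Nat.mul_le_mul_left a (h₁₂.trans h₂₃).le
      have := Nat.mul_le_mul_left b h₂₃.le
      have := Nat.zero_le (m₃ * i)
      nlinarith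
    simp [hE] at e1 e2 hE0
    refine ⟨i₁, a₁, b₁, j₁, ?_, ?_⟩
    · have e3 : m₃ * (i₁ + a₁ + b₁ + j₁) + m₃ = m₃ * (i + a + b + j) := by omega
      have e4 : i₁ + a₁ + b₁ + j₁ + 1 = i + a + b + j :=
        Nat.eq_of_mul_eq_mul_left h₃ (by linarith)
      zify at e4
      linarith
    · rw [hW₁]
      exact_mod_cast e2
  · exact (hs0 hcoeff).elim

theorem isMonomialDegree_of_isArithmeticallyCohenMacaulay [IsAlgClosed K] (h₁ : 0 < m₁)
    (h₁₂ : m₁ < m₂) (h₂₃ : m₂ < m₃)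
    (hCM : IsArithmeticallyCohenMacaulay (projMonomialCurve K ![m₁, m₂, m₃])) (D W : ℤ)
    (hD : IsMonomialDegree m₁ m₂ m₃ (D + 1) W)
    (hW : IsMonomialDegree m₁ m₂ m₃ (D + 1) (W + m₃)) : IsMonomialDegree m₁ m₂ m₃ D W := by
  rw [IsArithmeticallyCohenMacaulay] at hCM
  have hI : ∀ p, p ∈ homogeneousVanishingIdeal (projMonomialCurve K ![m₁, m₂, m₃]) ↔
      (aeval (genericZero K ![m₁, m₂, m₃])).toRingHom p = 0 := fun p => by
    rw [homogeneousVanishingIdeal_projMonomialCurve (exponent_le_last h₁₂ h₂₃)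
      (show 0 < m₃ by omega)]
    rfl
  generalize homogeneousVanishingIdeal (projMonomialCurve K ![m₁, m₂, m₃]) = I at hCM hI
  exact isMonomialDegree_of_isCohenMacaulayRing h₁ h₁₂ h₂₃ hCM (Ideal.Quotient.mk I)
    Ideal.Quotient.mk_surjective (Ideal.Quotient.lift I _ fun p hp => (hI p).mp hp)
    (RingHom.lift_injective_of_ker_le_ideal I _ fun p hp => (hI p).mpr hp)
    (fun p => Ideal.Quotient.lift_mk I _ _) D W hD hW

end Saturation

/-! ### Homogeneity of the forms F and G. -/

section Homogeneity

open MvPolynomial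

variable {K σ : Type*} [Field K] {α β c d p q p' q' : ℕ}

/-- Reduction by F preserves the degree αβ of f^α; division by x₂^(cd) lowers it by cd. -/
theorem reducedPower_exponent_add {k : ℕ} (hc : c < β) (hd : d < α) (h : α = c + p + q)
    (h' : β = d + p' + q') (hk : k ≤ α) :
    β * α - c * d = (β * (α - k) + c * (d * k / α) - c * d) + d * k % α +
      (p + q) * (d * k / α) + (p' + q') * k := by
  have e1 := mul_le_reducedPower_exponent hc hd hk
  have e2 := Nat.mod_add_div (d * k) α
  have e3 : c * d ≤ β * α := by nlinarith
  generalize d * k / α = Q at *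
  generalize d * k % α = r at *
  zify [e1, e3, hk] at *
  rw [show (p : ℤ) + q = α - c by linarith, show (p' : ℤ) + q' = β - d by linarith]
  linear_combination (-1) * e2

theorem isHomogeneous_X_pow_mul_X_pow (i j : σ) (a b : ℕ) :
    (X i ^ a * X j ^ b : MvPolynomial σ K).IsHomogeneous (a + b) :=
  (isHomogeneous_X_pow i a).mul (isHomogeneous_X_pow j b)

theorem isHomogeneous_binomialForm (h : α = c + p + q) (i₀ i₁ i₂ i₃ : σ) :
    (binomialForm α c p q (X i₀) (X i₁) (X i₂) (X i₃) : MvPolynomial σ K).IsHomogeneous α := by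
  refine (isHomogeneous_X_pow i₁ α).sub ?_
  have := (isHomogeneous_X_pow (R := K) i₂ c).mul (isHomogeneous_X_pow_mul_X_pow i₀ i₃ p q)
  rwa [← add_assoc, ← h] at this

theorem isHomogeneous_reducedPower (hc : c < β) (hd : d < α) (h : α = c + p + q)
    (h' : β = d + p' + q') (i₀ i₁ i₂ i₃ : σ) :
    (reducedPower α β c d p q p' q' (X i₀) (X i₁) (X i₂) (X i₃) :
      MvPolynomial σ K).IsHomogeneous (β * α - c * d) := by
  refine IsHomogeneous.sum _ _ _ fun k hk => ?_
  have hk : k ≤ α := Nat.lt_succ_iff.mp (Finset.mem_range.mp hk)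
  have hconst : ((-1) ^ k * (α.choose k : MvPolynomial σ K)) = C ((-1) ^ k * (α.choose k : K)) := by
    simp
  rw [hconst]
  have := ((((isHomogeneous_X_pow (R := K) i₂
    (β * (α - k) + c * (d * k / α) - c * d)).mul (isHomogeneous_X_pow i₁ (d * k % α))).mul
    ((isHomogeneous_X_pow_mul_X_pow i₀ i₃ p q).pow (d * k / α))).mul
    ((isHomogeneous_X_pow_mul_X_pow i₀ i₃ p' q').pow k)).C_mul ((-1) ^ k * (α.choose k : K))
  rwa [← reducedPower_exponent_add hc hd h h' hk] at this

end Homogeneity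

/-! ### Extending the parametrization to ℙ⁴. -/

section Extension

open MvPolynomial

variable {K : Type*} [Field K]

theorem genericZero_extension_zero (e₁ e₂ e₃ N : ℕ) :
    genericZero K ![e₁, e₂, e₃, N] 0 = X 0 ^ N := by
  change X 0 ^ (N - 0) * X 1 ^ 0 = _
  simp

theorem genericZero_extension_last (e₁ e₂ e₃ N : ℕ) :
    genericZero K ![e₁, e₂, e₃, N] 4 = X 1 ^ N := by
  change X 0 ^ (N - N) * X 1 ^ N = _
  simp

theorem genericZero_extension_one (e₁ e₂ e₃ N : ℕ) :
    genericZero K ![e₁, e₂, e₃, N] 1 = X 0 ^ (N - e₁) * X 1 ^ e₁ := rfl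

theorem genericZero_extension_two (e₁ e₂ e₃ N : ℕ) :
    genericZero K ![e₁, e₂, e₃, N] 2 = X 0 ^ (N - e₂) * X 1 ^ e₂ := rfl

theorem genericZero_extension_three (e₁ e₂ e₃ N : ℕ) :
    genericZero K ![e₁, e₂, e₃, N] 3 = X 0 ^ (N - e₃) * X 1 ^ e₃ := rfl

theorem binomialForm_parameter {R : Type*} [CommRing R] (u v : R) {e₁ e₂ e₃ N α c p q : ℕ}
    (h₁ : e₁ ≤ N) (h₂ : e₂ ≤ N) (h₃ : e₃ ≤ N) (hdeg : α = c + p + q)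
    (hw : α * e₁ = c * e₂ + q * e₃) :
    binomialForm α c p q (u ^ N) (u ^ (N - e₁) * v ^ e₁) (u ^ (N - e₂) * v ^ e₂)
      (u ^ (N - e₃) * v ^ e₃) = 0 := by
  have h := monomial_eval_eq u v h₁ h₂ h₃ 0 α 0 0
  have h' := monomial_eval_eq u v h₁ h₂ h₃ p 0 c q
  rw [show 0 + α + 0 + 0 = p + 0 + c + q by omega,
    show α * e₁ + 0 * e₂ + 0 * e₃ = 0 * e₁ + c * e₂ + q * e₃ by simpa using hw, ← h'] at h
  rw [binomialForm]
  linear_combination h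

/-- If `t^N = x^ℓ` with coprime exponents then `t` and `x` are powers of a common element. -/
theorem exists_common_root {ℓ N : ℕ} (hℓ : 0 < ℓ) (hN : 0 < N) (hcop : Nat.gcd ℓ N = 1) {t x : K}
    (h : t ^ N = x ^ ℓ) : ∃ v : K, t = v ^ ℓ ∧ x = v ^ N := by
  by_cases ht : t = 0
  · subst ht
    rw [zero_pow hN.ne'] at h
    refine ⟨0, by rw [zero_pow hℓ.ne'], ?_⟩
    rw [zero_pow hN.ne']
    exact eq_zero_of_pow_eq_zero h.symm
  · have hx : x ≠ 0 := by
      rintro rfl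
      rw [zero_pow hℓ.ne'] at h
      exact ht (eq_zero_of_pow_eq_zero h)
    have hab := Nat.gcd_eq_gcd_ab ℓ N
    rw [hcop, Nat.cast_one] at hab
    set a := Nat.gcdA ℓ N
    set b := Nat.gcdB ℓ N
    have h' : t ^ (N : ℤ) = x ^ (ℓ : ℤ) := by simpa using h
    refine ⟨t ^ a * x ^ b, ?_, ?_⟩
    · rw [mul_pow, ← zpow_natCast, ← zpow_natCast, ← zpow_mul, ← zpow_mul, mul_comm b, zpow_mul x,
        ← h', ← zpow_mul, ← zpow_add₀ ht, show a * ℓ + N * b = 1 by linarith, zpow_one]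
    · rw [mul_pow, ← zpow_natCast, ← zpow_natCast, ← zpow_mul, ← zpow_mul, mul_comm a, zpow_mul t,
        h', ← zpow_mul, ← zpow_add₀ hx, show ℓ * a + b * N = 1 by linarith, zpow_one]

theorem binomialForm_homogeneous {R : Type*} [CommRing R] {α c p q : ℕ} (h : α = c + p + q)
    (r x₀ x₁ x₂ x₃ : R) :
    binomialForm α c p q (r * x₀) (r * x₁) (r * x₂) (r * x₃) =
      r ^ α * binomialForm α c p q x₀ x₁ x₂ x₃ := by
  rw [binomialForm, binomialForm, h]
  ring

theorem reducedPower_homogeneous {R : Type*} [CommRing R] {α β c d p q p' q' : ℕ} (hc : c < β)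
    (hd : d < α) (h : α = c + p + q) (h' : β = d + p' + q') (r x₀ x₁ x₂ x₃ : R) :
    reducedPower α β c d p q p' q' (r * x₀) (r * x₁) (r * x₂) (r * x₃) =
      r ^ (β * α - c * d) * reducedPower α β c d p q p' q' x₀ x₁ x₂ x₃ := by
  rw [reducedPower, reducedPower, Finset.mul_sum]
  refine Finset.sum_congr rfl fun k hk => ?_
  have hk : k ≤ α := Nat.lt_succ_iff.mp (Finset.mem_range.mp hk)
  rw [reducedPower_exponent_add hc hd h h' hk]
  ring

end Extension

/-! ### The three hypersurfaces meet exactly in the curve. -/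

section Intersection

open MvPolynomial

variable {K : Type*} [Field K]

theorem projMonomialCurve_subset_zeroLocus {n : ℕ} {m : Fin n → ℕ}
    {S : Set (MvPolynomial (Fin (n + 1)) K)} (hS : ∀ f ∈ S, aeval (genericZero K m) f = 0) :
    projMonomialCurve K m ⊆ zeroLocus S :=
  fun _ hP f hf => hP f (hS f hf)

theorem mem_projMonomialCurve_extension_of_parameter [IsAlgClosed K] {e₁ e₂ e₃ N : ℕ} (h₁ : e₁ ≤ N)
    (h₂ : e₂ ≤ N) (h₃ : e₃ ≤ N) (hN : 0 < N) {P : ProjSpace K 4} (v : K)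
    (hr₁ : P.rep 1 = P.rep 0 * v ^ e₁) (hr₂ : P.rep 2 = P.rep 0 * v ^ e₂)
    (hr₃ : P.rep 3 = P.rep 0 * v ^ e₃) (hr₄ : P.rep 4 = P.rep 0 * v ^ N) :
    P ∈ projMonomialCurve K ![e₁, e₂, e₃, N] := by
  obtain ⟨u, hu⟩ := IsAlgClosed.exists_pow_nat_eq (P.rep 0) hN
  have key : ∀ e ≤ N, P.rep 0 * v ^ e = u ^ (N - e) * (u * v) ^ e := by
    intro e he
    rw [mul_pow, ← mul_assoc, ← pow_add, Nat.sub_add_cancel he, hu]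
  refine mem_projMonomialCurve_of_rep_eq u (u * v) fun i => ?_
  fin_cases i
  · change P.rep 0 = u ^ (N - 0) * (u * v) ^ 0
    simp [hu]
  · exact hr₁.trans (key e₁ h₁)
  · exact hr₂.trans (key e₂ h₂)
  · exact hr₃.trans (key e₃ h₃)
  · exact hr₄.trans (key N le_rfl)

theorem BinomialExponents.isSetTheoreticCompleteIntersectionCurve_extension [IsAlgClosed K]
    {m₁ m₂ m₃ α β c d p q p' q' : ℕ} (h : BinomialExponents m₁ m₂ m₃ α β c d p q p' q')
    (h₁ : 0 < m₁) (h₁₂ : m₁ < m₂) (h₂₃ : m₂ < m₃)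
    (hgcd : Nat.gcd m₁ (Nat.gcd m₂ m₃) = 1) {ℓ s : ℕ} (hℓ : 0 < ℓ) (hs : ℓ < s)
    (hcop : Nat.gcd ℓ (s * m₃) = 1) :
    IsSetTheoreticCompleteIntersectionCurve
      (projMonomialCurve K ![ℓ * m₁, ℓ * m₂, ℓ * m₃, s * m₃]) := by
  have h₂ : 0 < m₂ := h₁.trans h₁₂
  have h₃ : 0 < m₃ := h₂.trans h₂₃
  have hN : 0 < s * m₃ := Nat.mul_pos (hℓ.trans hs) h₃
  have hlt₃ : ℓ * m₃ < s * m₃ := Nat.mul_lt_mul_of_pos_right hs h₃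
  have hlt₂ : ℓ * m₂ < s * m₃ := (Nat.mul_lt_mul_of_pos_left h₂₃ hℓ).trans hlt₃
  have hlt₁ : ℓ * m₁ < s * m₃ := (Nat.mul_lt_mul_of_pos_left h₁₂ hℓ).trans hlt₂
  set F : MvPolynomial (Fin 5) K := binomialForm α c p q (X 0) (X 1) (X 2) (X 3) with hF
  set G : MvPolynomial (Fin 5) K := reducedPower α β c d p q p' q' (X 0) (X 1) (X 2) (X 3) with hG
  set H : MvPolynomial (Fin 5) K := binomialForm s ℓ (s - ℓ) 0 (X 0) (X 3) (X 4) (X 0) with hH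
  have hFx : ∀ x, eval x F = binomialForm α c p q (x 0) (x 1) (x 2) (x 3) := fun x => by
    simp [hF, map_binomialForm]
  have hGx : ∀ x, eval x G = reducedPower α β c d p q p' q' (x 0) (x 1) (x 2) (x 3) := fun x => by
    simp [hG, map_reducedPower]
  have hHx : ∀ x, eval x H = x 3 ^ s - x 4 ^ ℓ * x 0 ^ (s - ℓ) := fun x => by
    simp [hH, binomialForm]
  have hFne : F ≠ 0 := by
    intro h0
    have := hFx ![0, 1, 0, 0, 0]
    rw [h0, map_zero] at this
    have hne := h.add_ne_zero_fst h₁₂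
    simp only [binomialForm, Matrix.cons_val, one_pow, ← pow_add] at this
    rw [zero_pow (by omega), sub_zero] at this
    exact zero_ne_one this
  have hGne : G ≠ 0 := by
    intro h0
    have := hGx ![0, 0, 1, 0, 0]
    rw [h0, map_zero] at this
    simp [reducedPower_of_outer_eq_zero p q (h.add_ne_zero_snd h₁₂)] at this
  have hHne : H ≠ 0 := by
    intro h0
    have := hHx ![0, 0, 0, 1, 0]
    rw [h0, map_zero] at this
    simp [hℓ.ne'] at this
  have hw : ∀ {a b k e₁ e₂ e₃ : ℕ}, a * e₁ = b * e₂ + k * e₃ →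
      a * (ℓ * e₁) = b * (ℓ * e₂) + k * (ℓ * e₃) := by
    intro a b k e₁ e₂ e₃ h
    linear_combination ℓ * h
  have hFgen : aeval (genericZero K ![ℓ * m₁, ℓ * m₂, ℓ * m₃, s * m₃]) F = 0 := by
    rw [hF, map_binomialForm, aeval_X, aeval_X, aeval_X, aeval_X, genericZero_extension_zero,
      genericZero_extension_one, genericZero_extension_two, genericZero_extension_three]
    exact binomialForm_parameter _ _ hlt₁.le hlt₂.le hlt₃.le h.degree_fst (hw h.weight_fst)
  -- On the generic zero x₂^(cd) G = f^α = 0, and x₂ is nonzero in the domain K[u, v].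
  have hGgen : aeval (genericZero K ![ℓ * m₁, ℓ * m₂, ℓ * m₃, s * m₃]) G = 0 := by
    rw [hF, map_binomialForm] at hFgen
    have h0 := pow_mul_reducedPower p' q' h.c_lt h.d_lt hFgen
    rw [← map_reducedPower, aeval_X, aeval_X, aeval_X, aeval_X, genericZero_extension_zero,
      genericZero_extension_one, genericZero_extension_two, genericZero_extension_three,
      binomialForm_parameter _ _ hlt₂.le hlt₁.le hlt₃.le h.degree_snd (hw h.weight_snd),
      zero_pow (by have := h.d_lt; omega)] at h0
    exact (mul_eq_zero.mp h0).resolve_left (pow_ne_zero _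
      (mul_ne_zero (pow_ne_zero _ (X_ne_zero _)) (pow_ne_zero _ (X_ne_zero _))))
  have hHgen : aeval (genericZero K ![ℓ * m₁, ℓ * m₂, ℓ * m₃, s * m₃]) H = 0 := by
    have h0 := binomialForm_parameter (X 0 : MvPolynomial (Fin 2) K) (X 1) (p := s - ℓ) (q := 0)
      hlt₃.le le_rfl (Nat.zero_le (s * m₃)) (show s = ℓ + (s - ℓ) + 0 by omega)
      (show s * (ℓ * m₃) = ℓ * (s * m₃) + 0 * 0 by ring)
    rw [hH, map_binomialForm, aeval_X, aeval_X, aeval_X, genericZero_extension_zero,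
      genericZero_extension_three, genericZero_extension_last]
    simpa [binomialForm] using h0
  refine ⟨![F, G, H], ?_, Set.Subset.antisymm (projMonomialCurve_subset_zeroLocus ?_) ?_⟩
  · intro i
    fin_cases i
    · exact ⟨hFne, α, by have := h.d_lt; omega, isHomogeneous_binomialForm h.degree_fst 0 1 2 3⟩
    · exact ⟨hGne, _, h.exponent_pos,
        isHomogeneous_reducedPower h.c_lt h.d_lt h.degree_fst h.degree_snd 0 1 2 3⟩
    · exact ⟨hHne, s, by omega, isHomogeneous_binomialForm (by omega) 0 3 4 0⟩
  · rintro _ ⟨i, rfl⟩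
    fin_cases i
    · exact hFgen
    · exact hGgen
    · exact hHgen
  · intro P hP
    have hPF : eval P.rep F = 0 := hP F ⟨(0 : Fin 3), rfl⟩
    have hPG : eval P.rep G = 0 := hP G ⟨(1 : Fin 3), rfl⟩
    have hPH : eval P.rep H = 0 := hP H ⟨(2 : Fin 3), rfl⟩
    rw [hFx] at hPF
    rw [hGx] at hPG
    rw [hHx] at hPH
    by_cases hx₀ : P.rep 0 = 0
    · have hx₃ : P.rep 3 = 0 := by
        rw [hx₀, zero_pow (by omega), mul_zero, sub_zero] at hPH
        exact eq_zero_of_pow_eq_zero hPH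
      rw [hx₀, hx₃] at hPF hPG
      obtain ⟨hx₁, hx₂⟩ := h.eq_zero_of_outer_eq_zero h₁₂ hPF hPG
      obtain ⟨v, hv⟩ := IsAlgClosed.exists_pow_nat_eq (P.rep 4) hN
      refine mem_projMonomialCurve_of_rep_eq 0 v fun i => ?_
      have key : ∀ e < s * m₃, (0 : K) = 0 ^ (s * m₃ - e) * v ^ e := fun e he => by
        rw [zero_pow (by omega), zero_mul]
      fin_cases i
      · exact hx₀.trans (key 0 hN)
      · exact hx₁.trans (key _ hlt₁)
      · exact hx₂.trans (key _ hlt₂)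
      · exact hx₃.trans (key _ hlt₃)
      · change P.rep 4 = 0 ^ (s * m₃ - s * m₃) * v ^ (s * m₃)
        simp [hv]
    · obtain ⟨y, hy⟩ : ∃ y : Fin 5 → K, ∀ i, P.rep i = P.rep 0 * y i :=
        ⟨fun i => P.rep i / P.rep 0, fun i => (mul_div_cancel₀ _ hx₀).symm⟩
      -- Homogeneity reduces the case x₀ ≠ 0 to affine coordinates with x₀ = 1.
      have hy₀ : y 0 = 1 := mul_left_cancel₀ hx₀ (by rw [← hy 0, mul_one])
      rw [hy 1, hy 2, hy 3] at hPF hPG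
      nth_rw 1 [← mul_one (P.rep 0)] at hPF hPG
      rw [binomialForm_homogeneous h.degree_fst] at hPF
      rw [reducedPower_homogeneous h.c_lt h.d_lt h.degree_fst h.degree_snd] at hPG
      obtain ⟨t, ht₁, ht₂, ht₃⟩ := h.exists_parameter h₁ h₂ h₃ hgcd
        ((mul_eq_zero.mp hPF).resolve_left (pow_ne_zero _ hx₀))
        ((mul_eq_zero.mp hPG).resolve_left (pow_ne_zero _ hx₀))
      have hroot : t ^ (s * m₃) = y 4 ^ ℓ := by
        rw [mul_comm s, pow_mul, ← ht₃]
        rw [hy 3, hy 4, mul_pow, mul_pow, mul_right_comm, ← pow_add,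
          Nat.add_sub_cancel' hs.le, ← mul_sub] at hPH
        exact sub_eq_zero.mp ((mul_eq_zero.mp hPH).resolve_left (pow_ne_zero _ hx₀))
      obtain ⟨v, rfl, hv⟩ := exists_common_root hℓ hN hcop hroot
      refine mem_projMonomialCurve_extension_of_parameter hlt₁.le hlt₂.le hlt₃.le hN v ?_ ?_ ?_ ?_
      · rw [hy 1, ht₁, pow_mul]
      · rw [hy 2, ht₂, pow_mul]
      · rw [hy 3, ht₃, pow_mul]
      · rw [hy 4, hv]

end Intersection

end MonomialCurves

theorem corollary5p1 {K : Type*} [Field K] [IsAlgClosed K] [CharZero K]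
    (m₁ m₂ m₃ : ℕ) (hm₁ : 0 < m₁) (hm₁₂ : m₁ < m₂) (hm₂₃ : m₂ < m₃)
    (hgcd : Nat.gcd m₁ (Nat.gcd m₂ m₃) = 1)
    (hCM : MonomialCurves.IsArithmeticallyCohenMacaulay
      (MonomialCurves.projMonomialCurve K ![m₁, m₂, m₃]))
    (ℓ s₃ : ℕ) (hℓ : 0 < ℓ) (hs : ℓ < s₃) (hcop : Nat.gcd ℓ (s₃ * m₃) = 1) :
    MonomialCurves.IsSetTheoreticCompleteIntersectionCurve
      (MonomialCurves.projMonomialCurve K ![ℓ * m₁, ℓ * m₂, ℓ * m₃, s₃ * m₃]) := by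
  obtain ⟨α, β, c, d, p, q, p', q', h⟩ := MonomialCurves.exists_binomialExponents
    (MonomialCurves.isMonomialDegree_of_isArithmeticallyCohenMacaulay hm₁ hm₁₂ hm₂₃ hCM)
    hm₁₂ hm₂₃
  exact h.isSetTheoreticCompleteIntersectionCurve_extension hm₁ hm₁₂ hm₂₃ hgcd hℓ hs hcop
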